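/- Let $d\ge 1$ and let $w:\mathbb Z^d\times\mathbb Z^d\to[0,\infty)$ be a symmetric edge weight on the lattice graph $\mathbb Z^d$, with $w_{xy}>0$ exactly when $\sum_i|x_i-y_i|=1$. Equip $\mathbb Z^d$ with the vertex measure $\mu(x)=\sum_y w_{xy}$, and let $\Delta u(x)=\frac1{\mu(x)}\sum_y w_{xy}(u(y)-u(x))$ be the normalized Laplacian. Assume $$0<\inf_x\mu(x)\le\sup_x\mu(x)<\infty\qquad\text{and}\qquad \inf_{w_{xy}>0}w_{xy}>0 .$$ Let $E$ be the spectral measure of the bounded positive self-adjoint operator $-\Delta$ on $\ell^2(\mathbb Z^d,\mu)$, and define $$(-\Delta)^s=\int_{[0,\infty)}\lambda^s\,dE(\lambda)\quad(0<s<1),\qquad \log(-\Delta)=\int_{(0,\infty)}\log\lambda\,dE(\lambda),$$ the latter with domain $\{v\in\ell^2(\mathbb Z^d,\mu):\int_{(0,\infty)}(\log\lambda)^2\,d\langle E(\lambda)v,v\rangle<\infty\}$. Write $\|f\|_{\ell^p}=\big(\sum_x|f(x)|^p\mu(x)\big)^{1/p}$ for $p<\infty$ and $\|f\|_{\ell^\infty}=\sup_x|f(x)|$.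 Then every finitely supported $u:\mathbb Z^d\to\mathbb R$ lies in the domain of $\log(-\Delta)$, and for every $1<p\le\infty$ $$\log(-\Delta)u\in\ell^p(\mathbb Z^d)\qquad\text{and}\qquad \lim_{s\to0^+}\Big\|\frac{(-\Delta)^su-u}{s}-\log(-\Delta)u\Big\|_{\ell^p}=0 .$$ -/

import Mathlib

open MeasureTheory Filter Topology
open scoped ENNReal InnerProductSpace CompactlySupported

noncomputable section

/-! ### Spectral calculus of a bounded self-adjoint operator -/

section Spectral

variable {H : Type*} [NormedAddCommGroup H] [InnerProductSpace ℂ H] [CompleteSpace H]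

/-- The positive linear functional `f ↦ ⟪u, f(A) u⟫` on compactly supported continuous functions
on the real line (for self-adjoint `A`). -/
def spectralFunctional (A : H →L[ℂ] H) (u : H) : C_c(ℝ, ℝ) →ₚ[ℝ] ℝ :=
  PositiveLinearMap.mk₀
    { toFun := fun f => (⟪u, cfc (fun x : ℝ => f x) A u⟫_ℂ).re
      map_add' := fun f g => by
        have h : cfc (fun x : ℝ => (f + g) x) A
            = cfc (fun x : ℝ => f x) A + cfc (fun x : ℝ => g x) A :=
          cfc_add A (fun x : ℝ => f x) (fun x : ℝ => g x) f.continuous.continuousOn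
            g.continuous.continuousOn
        rw [h, add_apply, inner_add_right, Complex.add_re]
      map_smul' := fun c f => by
        have h : cfc (fun x : ℝ => (c • f) x) A = c • cfc (fun x : ℝ => f x) A :=
          cfc_smul c (fun x : ℝ => f x) A f.continuous.continuousOn
        rw [h, smul_apply, inner_smul_right_eq_smul]
        simp }
    (fun f hf => by
      have h : 0 ≤ cfc (fun x : ℝ => f x) A := cfc_nonneg fun x _ => hf x
      exact ((ContinuousLinearMap.nonneg_iff_isPositive _).1 h).re_inner_nonneg_right u)

/-- The scalar spectral measure `E_{u,u}(B) = ⟪u, E(B) u⟫` of a bounded self-adjoint operator `A`,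
where `E` is the projection-valued spectral measure of `A`: the Borel measure on the real line that
represents the functional `f ↦ ⟪u, f(A) u⟫`. -/
def spectralMeasure (A : H →L[ℂ] H) (u : H) : Measure ℝ :=
  RealRMK.rieszMeasure (spectralFunctional A u)

/-- The domain of `φ(A) = ∫ φ dE`: the vectors `u` with `∫ |φ|² dE_{u,u} < ∞`. -/
def spectralDomain (A : H →L[ℂ] H) (φ : ℝ → ℝ) : Set H :=
  {u | MemLp φ 2 (spectralMeasure A u)}

/-- The integral `∫ φ dE_{u,v}` against the complex measure `E_{u,v}(B) = ⟨E(B) u, v⟩`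
(linear in `u`, conjugate linear in `v`), which is expressed by polarization as
`E_{u,v} = (E_{u+v,u+v} - E_{u-v,u-v} + i E_{u+iv,u+iv} - i E_{u-iv,u-iv}) / 4`.
For `u`, `v` in the domain of `φ(A)` all four integrals converge absolutely. -/
def spectralPairing (A : H →L[ℂ] H) (φ : ℝ → ℝ) (u v : H) : ℂ :=
  (((∫ r, φ r ∂(spectralMeasure A (u + v)) : ℝ) : ℂ)
    - ((∫ r, φ r ∂(spectralMeasure A (u - v)) : ℝ) : ℂ)
    + Complex.I * ((∫ r, φ r ∂(spectralMeasure A (u + Complex.I • v)) : ℝ) : ℂ)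
    - Complex.I * ((∫ r, φ r ∂(spectralMeasure A (u - Complex.I • v)) : ℝ) : ℂ)) / 4

/-- `z = φ(A) u`, the operator `φ(A) = ∫ φ dE` of the Borel functional calculus: `u` lies in the
domain of `φ(A)`, and `⟨z, v⟩ = ∫ φ dE_{u,v}` for all `v` in that (dense) domain. Mathlib's inner
product is conjugate linear in its first argument, so `⟨z, v⟩` is `⟪v, z⟫_ℂ`. -/
structure IsSpectralValue (A : H →L[ℂ] H) (φ : ℝ → ℝ) (u z : H) : Prop where
  mem_domain : u ∈ spectralDomain A φ
  inner_eq : ∀ v ∈ spectralDomain A φ, ⟪v, z⟫_ℂ = spectralPairing A φ u v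

end Spectral

/-! ### Weighted graphs and the normalized Laplacian -/

/-- A weighted graph on the vertex set `V`: a symmetric edge weight `w ≥ 0` without loops and with
finite weighted degrees. Two vertices `x`, `y` are adjacent when `0 < w x y`. -/
structure WeightedGraph (V : Type*) where
  w : V → V → ℝ
  nonneg : ∀ x y, 0 ≤ w x y
  symm : ∀ x y, w x y = w y x
  loopless : ∀ x, w x x = 0
  summable : ∀ x, Summable (w x)

namespace WeightedGraph

variable {V : Type*} (G : WeightedGraph V)

/-- The weighted degree `m(x) = ∑_y w_{xy}`. For the normalized Laplacian it is also the vertex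
measure `μ(x)`. -/
def degree (x : V) : ℝ := ∑' y, G.w x y

variable [MeasurableSpace V]

/-- The vertex measure `μ = m` of the normalized Laplacian, as a measure on `V`, so that
`∫ u dμ = ∑_x u(x) μ(x)` and `ℓ^p(V, μ)` is the `L^p` space of this measure. -/
def vertexMeasure : Measure V :=
  Measure.sum fun x => ENNReal.ofReal (G.degree x) • Measure.dirac x

/-- The measure on pairs of vertices with mass `w_{xy}` at `(x, y)`. -/
def edgeMeasure : Measure (V × V) :=
  Measure.sum fun q : V × V => ENNReal.ofReal (G.w q.1 q.2) • Measure.dirac q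

variable [MeasurableSingletonClass V]

theorem measurePreserving_fst :
    MeasurePreserving (Prod.fst : V × V → V) G.edgeMeasure G.vertexMeasure := by
  refine ⟨measurable_fst, ?_⟩
  ext s hs
  rw [Measure.map_apply measurable_fst hs, edgeMeasure, vertexMeasure,
    Measure.sum_apply _ (measurable_fst hs), Measure.sum_apply _ hs, ENNReal.tsum_prod']
  refine tsum_congr fun x => ?_
  simp only [Measure.smul_apply, smul_eq_mul, Measure.dirac_apply]
  change ∑' y, ENNReal.ofReal (G.w x y) * s.indicator 1 x = _
  rw [ENNReal.tsum_mul_right, degree, ENNReal.ofReal_tsum_of_nonneg (G.nonneg x) (G.summable x)]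

theorem measurePreserving_snd :
    MeasurePreserving (Prod.snd : V × V → V) G.edgeMeasure G.vertexMeasure := by
  refine ⟨measurable_snd, ?_⟩
  ext s hs
  rw [Measure.map_apply measurable_snd hs, edgeMeasure, vertexMeasure,
    Measure.sum_apply _ (measurable_snd hs), Measure.sum_apply _ hs, ENNReal.tsum_prod',
    ENNReal.tsum_comm]
  refine tsum_congr fun x => ?_
  simp only [Measure.smul_apply, smul_eq_mul, Measure.dirac_apply]
  change ∑' y, ENNReal.ofReal (G.w y x) * s.indicator 1 x = _
  rw [ENNReal.tsum_mul_right, degree, ENNReal.ofReal_tsum_of_nonneg (G.nonneg x) (G.summable x)]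
  simp only [G.symm _ x]

/-- The difference operator `(∇f)(x, y) = f(x) - f(y)` from `ℓ²(V, μ)` to the square-integrable
functions on pairs of vertices with weight `w`. -/
def gradient : Lp ℂ 2 G.vertexMeasure →L[ℂ] Lp ℂ 2 G.edgeMeasure :=
  (Lp.compMeasurePreservingₗᵢ ℂ Prod.fst G.measurePreserving_fst).toContinuousLinearMap
    - (Lp.compMeasurePreservingₗᵢ ℂ Prod.snd G.measurePreserving_snd).toContinuousLinearMap

/-- The operator `-Δ` on `ℓ²(V, μ)`: the (bounded, positive) operator of the energy form, with
`⟨-Δ f, g⟩ = (1/2) ∑_{x,y} w_{xy} (f(x) - f(y)) conj (g(x) - g(y))`.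
Pointwise it is `-Δ f(x) = (1/μ(x)) ∑_y w_{xy} (f(x) - f(y))`; see `negLaplacian_apply`. -/
def negLaplacian : Lp ℂ 2 G.vertexMeasure →L[ℂ] Lp ℂ 2 G.vertexMeasure :=
  (1 / 2 : ℂ) • (ContinuousLinearMap.adjoint G.gradient ∘L G.gradient)

theorem vertexMeasure_singleton (x : V) :
    G.vertexMeasure {x} = ENNReal.ofReal (G.degree x) :=
  Measure.sum_smul_dirac_singleton

theorem edgeMeasure_singleton (q : V × V) :
    G.edgeMeasure {q} = ENNReal.ofReal (G.w q.1 q.2) :=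
  Measure.sum_smul_dirac_singleton (f := fun q : V × V => ENNReal.ofReal (G.w q.1 q.2))

theorem gradient_coeFn (f : Lp ℂ 2 G.vertexMeasure) :
    ⇑(G.gradient f) =ᵐ[G.edgeMeasure] fun q => f q.1 - f q.2 := by
  have h1 := Lp.coeFn_compMeasurePreserving f G.measurePreserving_fst
  have h2 := Lp.coeFn_compMeasurePreserving f G.measurePreserving_snd
  have h3 := Lp.coeFn_sub (Lp.compMeasurePreserving Prod.fst G.measurePreserving_fst f)
    (Lp.compMeasurePreserving Prod.snd G.measurePreserving_snd f)
  filter_upwards [h1, h2, h3] with q a1 a2 a3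
  refine a3.trans ?_
  rw [Pi.sub_apply, a1, a2]
  rfl

open scoped ComplexOrder in
/-- `-Δ` is self-adjoint and positive. -/
theorem negLaplacian_isPositive : G.negLaplacian.IsPositive := by
  have h := ContinuousLinearMap.isPositive_adjoint_comp_self G.gradient
  have h2 : (0 : ℂ) ≤ 1 / 2 := by
    rw [Complex.le_def]; norm_num
  exact h.smul_of_nonneg h2

/-- The pointwise formula for the normalized Laplacian. -/
theorem negLaplacian_apply [Countable V] (f : Lp ℂ 2 G.vertexMeasure) (x : V) (hx : 0 < G.degree x) :
    G.negLaplacian f x = (G.degree x : ℂ)⁻¹ * ∑' y, (G.w x y : ℂ) * (f x - f y) := by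
  have hs : MeasurableSet ({x} : Set V) := measurableSet_singleton x
  have hμ : G.vertexMeasure {x} ≠ ∞ := by
    rw [vertexMeasure_singleton]; exact ENNReal.ofReal_ne_top
  have hν1 : G.edgeMeasure (Prod.fst ⁻¹' {x}) ≠ ∞ := by
    rwa [G.measurePreserving_fst.measure_preimage hs.nullMeasurableSet]
  have hν2 : G.edgeMeasure (Prod.snd ⁻¹' {x}) ≠ ∞ := by
    rwa [G.measurePreserving_snd.measure_preimage hs.nullMeasurableSet]
  set δ : Lp ℂ 2 G.vertexMeasure := indicatorConstLp 2 hs hμ (1 : ℂ) with hδ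
  have key : (G.degree x : ℂ) * G.negLaplacian f x = ⟪δ, G.negLaplacian f⟫_ℂ := by
    rw [hδ, L2.inner_indicatorConstLp_one, integral_singleton, measureReal_def,
      vertexMeasure_singleton, ENNReal.toReal_ofReal hx.le]
    simp
  have hgδ : G.gradient δ
      = indicatorConstLp 2 (hs.preimage measurable_fst) hν1 (1 : ℂ)
        - indicatorConstLp 2 (hs.preimage measurable_snd) hν2 (1 : ℂ) := by
    rw [← Lp.indicatorConstLp_compMeasurePreserving hs hμ 1 G.measurePreserving_fst,
      ← Lp.indicatorConstLp_compMeasurePreserving hs hμ 1 G.measurePreserving_snd]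
    rfl
  have hg := G.gradient_coeFn f
  have i0 : ∀ s : Set (V × V), MeasurableSet s → G.edgeMeasure s ≠ ∞ →
      Integrable (s.indicator fun q => f q.1 - f q.2) G.edgeMeasure := fun s hms hfin =>
    (integrable_indicator_iff hms).2 <|
      (integrableOn_Lp_of_measure_ne_top (G.gradient f) (by norm_num) hfin).congr
        (ae_restrict_of_ae hg)
  have h1 : ∫ q in Prod.fst ⁻¹' {x}, G.gradient f q ∂G.edgeMeasure
      = ∑' y, (G.w x y : ℂ) * (f x - f y) := by
    rw [setIntegral_congr_ae (hs.preimage measurable_fst) (hg.mono fun q h _ => h),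
      ← integral_indicator (hs.preimage measurable_fst)]
    have hi := i0 _ (hs.preimage measurable_fst) hν1
    rw [integral_countable hi]
    rw [← (Prod.mk_right_injective x).tsum_eq]
    · refine tsum_congr fun y => ?_
      rw [measureReal_def, edgeMeasure_singleton, ENNReal.toReal_ofReal (G.nonneg _ _)]
      simp
    · intro q hq
      by_contra hc
      apply hq
      have : q.1 ≠ x := fun h => hc ⟨q.2, by rw [← h]⟩
      simp [this]
  have h2 : ∫ q in Prod.snd ⁻¹' {x}, G.gradient f q ∂G.edgeMeasure
      = - ∑' y, (G.w x y : ℂ) * (f x - f y) := by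
    rw [setIntegral_congr_ae (hs.preimage measurable_snd) (hg.mono fun q h _ => h),
      ← integral_indicator (hs.preimage measurable_snd)]
    have hi := i0 _ (hs.preimage measurable_snd) hν2
    rw [integral_countable hi, ← tsum_neg]
    rw [← (Prod.mk_left_injective x).tsum_eq]
    · refine tsum_congr fun y => ?_
      rw [measureReal_def, edgeMeasure_singleton, ENNReal.toReal_ofReal (G.nonneg _ _)]
      simp only [Set.mem_preimage, Set.mem_singleton_iff, Set.indicator_of_mem, G.symm y x,
        Complex.real_smul]
      ring
    · intro q hq
      by_contra hc
      apply hq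
      have : q.2 ≠ x := fun h => hc ⟨q.1, by rw [← h]⟩
      simp [this]
  have h3 : ⟪δ, G.negLaplacian f⟫_ℂ = ∑' y, (G.w x y : ℂ) * (f x - f y) := by
    rw [negLaplacian, smul_apply, inner_smul_right, ContinuousLinearMap.comp_apply,
      ContinuousLinearMap.adjoint_inner_right, hgδ, inner_sub_left,
      L2.inner_indicatorConstLp_one, L2.inner_indicatorConstLp_one, h1, h2]
    ring
  have hx' : (G.degree x : ℂ) ≠ 0 := by exact_mod_cast hx.ne'
  rw [← h3, ← key, inv_mul_cancel_left₀ hx']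

/-- `z = φ(-Δ) u` for real-valued functions `u`, `z` in `ℓ²(V, μ)`. -/
def IsFunctionOfNegLaplacian (φ : ℝ → ℝ) (u z : V → ℝ) : Prop :=
  ∃ (hu : MemLp (fun x => (u x : ℂ)) 2 G.vertexMeasure)
    (hz : MemLp (fun x => (z x : ℂ)) 2 G.vertexMeasure),
    IsSpectralValue G.negLaplacian φ (hu.toLp _) (hz.toLp _)

/-- `z = (-Δ)^s u`, with `(-Δ)^s = ∫_{[0,∞)} λ^s dE(λ)`. -/
def IsFractionalLaplacian (s : ℝ) (u z : V → ℝ) : Prop :=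
  G.IsFunctionOfNegLaplacian (fun r => r ^ s) u z

/-- `z = log(-Δ) u`, with `log(-Δ) = ∫_{(0,∞)} log λ dE(λ)`. The point `0` does not contribute
because `Real.log 0 = 0`. -/
def IsLogLaplacian (u z : V → ℝ) : Prop :=
  G.IsFunctionOfNegLaplacian Real.log u z

end WeightedGraph

/-- A weighted graph on `ℤ^d` is a weighted lattice graph if its edges are exactly the pairs of
nearest neighbours, those at `ℓ¹`-distance one. -/
def IsWeightedLattice {d : ℕ} (G : WeightedGraph (Fin d → ℤ)) : Prop :=
  ∀ x y, 0 < G.w x y ↔ ∑ i, |x i - y i| = 1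

end

/-! With `P = 1 - (-Δ)`, the transition operator of the random walk, the expansions of `log (1 - t)`
and `(1 - t) ^ s` at `t = 0` suggest log(-Δ)u = -∑ P^(n+1)u / (n+1) and (-Δ)^s u = u - s ∑ α_n(s)
P^(n+1)u / (n+1), where α_n(s) is `binomialFactor s n`. The error in the limit is then ∑ (1 -
α_n(s)) P^(n+1)u / (n+1). Since 0 ≤ α_n(s) ≤ 1 and α_n(s) → 1 as s → 0+, dominated convergence for
series finishes the proof once ∑ ‖P^(n+1)u‖_p / (n+1) is finite, for which any polynomial decay
suffices.

The decay comes from a Nash argument (`LocallyFinite.nash`). The drop ‖f‖₂² - ‖Pf‖₂² is a sum of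
variances, hence controls the differences f(z+e) - f(z-e) along one lattice direction; a
one-dimensional Sobolev inequality and the ℓ¹ contractivity of `P` turn this into a recursion for
‖Pⁿu‖₂² that forces |Pⁿu| ≤ C n^(-1/4). Interpolation with ℓ¹ gives a positive rate in ℓ^p exactly
when p > 1. Working with two steps of the walk avoids the parity obstruction at the eigenvalue -1 of
`P`.

The series must still be identified with the spectral integrals (`isSpectralValue_of_series`). As Pⁿ
→ 0 strongly, all scalar spectral measures live on (0, 2), where the partial sums converge to φ and
are bounded by |φ| + C. Fatou's lemma puts u in the domain, and dominated convergence identifies the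
limit. -/

noncomputable section

/-! ### Scalar spectral measures and limits of the continuous functional calculus -/

section SpectralMeasure

variable {H : Type*} [NormedAddCommGroup H] [InnerProductSpace ℂ H] [CompleteSpace H]

theorem integral_spectralMeasure_compactlySupported (A : H →L[ℂ] H) (u : H) (f : C_c(ℝ, ℝ)) :
    ∫ r, f r ∂(spectralMeasure A u) = (⟪u, cfc (fun x : ℝ => f x) A u⟫_ℂ).re :=
  RealRMK.integral_rieszMeasure (spectralFunctional A u) f

instance (A : H →L[ℂ] H) (u : H) : (spectralMeasure A u).Regular :=
  inferInstanceAs (RealRMK.rieszMeasure _).Regular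

/-- The spectrum of a bounded operator lies in some interval `[-R, R]`. -/
theorem exists_spectrum_real_subset_Icc (A : H →L[ℂ] H) :
    ∃ R : ℝ, 0 ≤ R ∧ spectrum ℝ A ⊆ Set.Icc (-R) R := by
  obtain ⟨R, hR⟩ := (spectrum.isCompact (𝕜 := ℝ) A).isBounded.subset_closedBall 0
  refine ⟨max R 0, le_max_right _ _, fun x hx => ?_⟩
  have := hR hx
  rw [mem_closedBall_zero_iff, Real.norm_eq_abs] at this
  exact abs_le.1 (this.trans (le_max_left _ _))

/-- A continuous function on the line cut off outside of `[-R - 1, R + 1]`. -/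
def cutoff (R : ℝ) (f : ℝ → ℝ) (hf : Continuous f) : C_c(ℝ, ℝ) where
  toFun x := max 0 (min 1 (R + 1 - |x|)) * f x
  continuous_toFun := by fun_prop
  hasCompactSupport' := by
    refine HasCompactSupport.intro (isCompact_Icc (a := -(R + 1)) (b := R + 1)) fun x hx => ?_
    have : R + 1 < |x| := by
      by_contra! h
      exact hx (abs_le.1 h)
    rw [max_eq_left ((min_le_right _ _).trans (by linarith)), zero_mul]

theorem cutoff_apply (R : ℝ) (f : ℝ → ℝ) (hf : Continuous f) (x : ℝ) :
    cutoff R f hf x = max 0 (min 1 (R + 1 - |x|)) * f x := rfl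

theorem cutoff_eq (R : ℝ) (f : ℝ → ℝ) (hf : Continuous f) {x : ℝ} (hx : x ∈ Set.Icc (-R) R) :
    cutoff R f hf x = f x := by
  have : |x| ≤ R := abs_le.2 hx
  rw [cutoff_apply, min_eq_left (by linarith), max_eq_right zero_le_one, one_mul]

/-- The function max(0, |r| - R) vanishes on the spectrum, so each of its compactly supported
truncations has integral zero. This is what extends the defining identity from compactly supported
to all continuous functions. -/
theorem ae_spectralMeasure_mem_Icc (A : H →L[ℂ] H) (u : H) {R : ℝ}
    (hR : spectrum ℝ A ⊆ Set.Icc (-R) R) :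
    ∀ᵐ r ∂(spectralMeasure A u), r ∈ Set.Icc (-R) R := by
  have key : ∀ K : ℕ, ∀ᵐ r : ℝ ∂(spectralMeasure A u), |r| ≤ K → r ∈ Set.Icc (-R) R := by
    intro K
    have hc : Continuous fun r : ℝ => max 0 (|r| - R) := by fun_prop
    have h0 : ∫ r, cutoff K _ hc r ∂(spectralMeasure A u) = 0 := by
      rw [integral_spectralMeasure_compactlySupported]
      have : cfc (fun x : ℝ => cutoff K _ hc x) A = cfc (fun _ : ℝ => (0 : ℝ)) A := by
        refine cfc_congr fun x hx => ?_
        have : |x| ≤ R := abs_le.2 (hR hx)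
        simp [cutoff_apply, this]
      rw [this, cfc_const_zero]
      simp
    rw [integral_eq_zero_iff_of_nonneg] at h0
    · filter_upwards [h0] with r hr hrK
      refine abs_le.1 ?_
      by_contra! h
      rw [cutoff_apply, min_eq_left (by linarith), max_eq_right zero_le_one, one_mul,
        max_eq_right (by linarith)] at hr
      have : |r| - R = 0 := hr
      linarith
    · intro r
      rw [cutoff_apply]
      exact mul_nonneg (le_max_left _ _) (le_max_left _ _)
    · exact (cutoff K _ hc).continuous.integrable_of_hasCompactSupport
        (cutoff K _ hc).hasCompactSupport
  filter_upwards [ae_all_iff.2 key] with r hr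
  obtain ⟨K, hK⟩ := exists_nat_ge |r|
  exact hr K hK

instance (A : H →L[ℂ] H) (u : H) : IsFiniteMeasure (spectralMeasure A u) := by
  obtain ⟨R, -, hR⟩ := exists_spectrum_real_subset_Icc A
  refine ⟨?_⟩
  rw [← measure_inter_add_sdiff Set.univ (measurableSet_Icc (a := -R) (b := R)), Set.univ_inter]
  have : spectralMeasure A u (Set.univ \ Set.Icc (-R) R) = 0 := by
    rw [← Set.compl_eq_univ_sdiff]
    exact ae_spectralMeasure_mem_Icc A u hR
  rw [this, add_zero]
  exact isCompact_Icc.measure_lt_top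

theorem ae_cutoff_eq (A : H →L[ℂ] H) (u : H) {R : ℝ} (hR : spectrum ℝ A ⊆ Set.Icc (-R) R)
    {f : ℝ → ℝ} (hf : Continuous f) : cutoff R f hf =ᵐ[spectralMeasure A u] f := by
  filter_upwards [ae_spectralMeasure_mem_Icc A u hR] with r hr
  exact cutoff_eq R f hf hr

theorem integrable_spectralMeasure (A : H →L[ℂ] H) (u : H) {f : ℝ → ℝ} (hf : Continuous f) :
    Integrable f (spectralMeasure A u) := by
  obtain ⟨R, -, hR⟩ := exists_spectrum_real_subset_Icc A
  exact ((cutoff R f hf).continuous.integrable_of_hasCompactSupport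
    (cutoff R f hf).hasCompactSupport).congr (ae_cutoff_eq A u hR hf)

theorem integral_spectralMeasure (A : H →L[ℂ] H) (u : H) {f : ℝ → ℝ} (hf : Continuous f) :
    ∫ r, f r ∂(spectralMeasure A u) = (⟪u, cfc f A u⟫_ℂ).re := by
  obtain ⟨R, -, hR⟩ := exists_spectrum_real_subset_Icc A
  rw [← integral_congr_ae (ae_cutoff_eq A u hR hf), integral_spectralMeasure_compactlySupported]
  have : cfc (fun x : ℝ => cutoff R f hf x) A = cfc f A :=
    cfc_congr fun x hx => cutoff_eq R f hf (hR hx)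
  rw [this]

theorem inner_cfc_self_eq_integral (A : H →L[ℂ] H) (u : H) {f : ℝ → ℝ} (hf : Continuous f) :
    ⟪cfc f A u, u⟫_ℂ = ((∫ r, f r ∂(spectralMeasure A u) : ℝ) : ℂ) := by
  have hs : IsSelfAdjoint (cfc f A) := cfc_predicate f A
  rw [integral_spectralMeasure A u hf]
  have h1 := hs.isSymmetric u u
  have h2 : ⟪cfc f A u, u⟫_ℂ = ⟪u, cfc f A u⟫_ℂ := h1
  rw [h2]
  refine (Complex.conj_eq_iff_re.1 ?_).symm
  rw [inner_conj_symm, h2]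

/-- For continuous functions the spectral pairing is given by the continuous functional
calculus. -/
theorem spectralPairing_eq_inner (A : H →L[ℂ] H) (u v : H) {f : ℝ → ℝ} (hf : Continuous f) :
    spectralPairing A f u v = ⟪v, cfc f A u⟫_ℂ := by
  have hs : IsSelfAdjoint (cfc f A) := cfc_predicate f A
  have h := inner_map_polarization (cfc f A).toLinearMap u v
  simp only [ContinuousLinearMap.coe_coe] at h
  rw [inner_cfc_self_eq_integral A _ hf, inner_cfc_self_eq_integral A _ hf,
    inner_cfc_self_eq_integral A _ hf, inner_cfc_self_eq_integral A _ hf] at h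
  exact h.symm.trans (hs.isSymmetric v u)

theorem integral_sq_spectralMeasure (A : H →L[ℂ] H) (u : H) {f : ℝ → ℝ} (hf : Continuous f) :
    ∫ r, f r ^ 2 ∂(spectralMeasure A u) = ‖cfc f A u‖ ^ 2 := by
  have hs : IsSelfAdjoint (cfc f A) := cfc_predicate f A
  rw [integral_spectralMeasure A u (by fun_prop)]
  have : cfc (fun r => f r ^ 2) A = cfc f A * cfc f A := by
    rw [← cfc_mul f f A hf.continuousOn hf.continuousOn]
    simp only [sq]
  have h2 : ⟪cfc f A u, cfc f A u⟫_ℂ = ⟪u, cfc f A (cfc f A u)⟫_ℂ := hs.isSymmetric u (cfc f A u)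
  rw [this, mul_apply_eq_comp, ← h2]
  exact inner_self_eq_norm_sq (𝕜 := ℂ) _

/-- The quadratic form ⟪u, f(A)u⟫ obeys the parallelogram law, and finite measures are determined by
bounded continuous functions. The resulting domination makes a function integrable for u and v
integrable for every measure in the polarization formula. -/
theorem spectralMeasure_parallelogram (A : H →L[ℂ] H) (u v : H) :
    spectralMeasure A (u + v) + spectralMeasure A (u - v)
      = 2 • (spectralMeasure A u + spectralMeasure A v) := by
  rw [two_smul]
  refine ext_of_forall_integral_eq_of_IsFiniteMeasure fun f => ?_
  have hf : Continuous f := f.continuous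
  have hi := fun w => integrable_spectralMeasure A w hf
  rw [integral_add_measure (hi _) (hi _), integral_add_measure ((hi _).add_measure (hi _))
    ((hi _).add_measure (hi _)), integral_add_measure (hi _) (hi _)]
  simp only [integral_spectralMeasure A _ hf, map_add, map_sub, inner_add_left, inner_add_right,
    inner_sub_left, inner_sub_right, Complex.add_re, Complex.sub_re]
  ring

theorem spectralMeasure_I_smul (A : H →L[ℂ] H) (u : H) :
    spectralMeasure A (Complex.I • u) = spectralMeasure A u := by
  refine ext_of_forall_integral_eq_of_IsFiniteMeasure fun f => ?_
  have hf : Continuous f := f.continuous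
  rw [integral_spectralMeasure A _ hf, integral_spectralMeasure A _ hf, map_smul, inner_smul_left,
    inner_smul_right, ← mul_assoc]
  simp

theorem spectralMeasure_add_le (A : H →L[ℂ] H) (u v : H) :
    spectralMeasure A (u + v) ≤ 2 • (spectralMeasure A u + spectralMeasure A v) := by
  rw [← spectralMeasure_parallelogram]
  exact Measure.le_add_right le_rfl

theorem spectralMeasure_sub_le (A : H →L[ℂ] H) (u v : H) :
    spectralMeasure A (u - v) ≤ 2 • (spectralMeasure A u + spectralMeasure A v) := by
  rw [← spectralMeasure_parallelogram]
  exact Measure.le_add_left le_rfl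

/-- If the functions `f n` converge to `φ` almost everywhere for all spectral measures, with
`|f n| ≤ |φ| + C`, and `f n (A) u` converges to `z`, then `z = φ(A) u`. -/
theorem isSpectralValue_of_tendsto (A : H →L[ℂ] H) {φ : ℝ → ℝ} {f : ℕ → ℝ → ℝ} {u z : H} {C : ℝ}
    (hf : ∀ n, Continuous (f n))
    (hlim : ∀ w, ∀ᵐ r ∂(spectralMeasure A w), Tendsto (fun n => f n r) atTop (𝓝 (φ r)))
    (hbound : ∀ w, ∀ᵐ r ∂(spectralMeasure A w), ∀ n, |f n r| ≤ |φ r| + C)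
    (hz : Tendsto (fun n => cfc (f n) A u) atTop (𝓝 z)) :
    IsSpectralValue A φ u z := by
  have hφm : ∀ w, AEStronglyMeasurable φ (spectralMeasure A w) := fun w =>
    aestronglyMeasurable_of_tendsto_ae atTop (fun n => (hf n).aestronglyMeasurable) (hlim w)
  -- Fatou: the L² norm of `f n` under E_{u,u} is the norm of `f n (A) u`, which is bounded along a
  -- convergent sequence.
  have hu : u ∈ spectralDomain A φ := by
    refine ⟨hφm u, ?_⟩
    obtain ⟨M, hM⟩ := (Metric.isBounded_range_of_tendsto _ hz).exists_norm_le
    have hn : ∀ n, eLpNorm (f n) 2 (spectralMeasure A u) ≤ ENNReal.ofReal M := by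
      intro n
      have hmem : MemLp (f n) 2 (spectralMeasure A u) :=
        (memLp_two_iff_integrable_sq (hf n).aestronglyMeasurable).2
          (integrable_spectralMeasure A u (by fun_prop))
      rw [hmem.eLpNorm_eq_integral_rpow_norm two_ne_zero ENNReal.ofNat_ne_top]
      refine ENNReal.ofReal_le_ofReal ?_
      have : ∀ r, ‖f n r‖ ^ (2 : ℝ≥0∞).toReal = f n r ^ 2 := fun r => by simp
      simp only [this]
      rw [integral_sq_spectralMeasure A u (hf n)]
      have h2 : (2 : ℝ≥0∞).toReal⁻¹ = ((2 : ℕ) : ℝ)⁻¹ := by simp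
      rw [h2, Real.pow_rpow_inv_natCast (norm_nonneg _) two_ne_zero]
      exact hM _ ⟨n, rfl⟩
    refine (Lp.eLpNorm_lim_le_liminf_eLpNorm (fun n => (hf n).aestronglyMeasurable) φ
      (hlim u)).trans_lt (lt_of_le_of_lt ?_ (ENNReal.ofReal_lt_top (r := M)))
    exact liminf_le_of_le (by isBoundedDefault) fun b hb =>
      let ⟨n, h⟩ := hb.exists; h.trans (hn n)
  refine ⟨hu, fun v hv => ?_⟩
  have hint : ∀ w ∈ spectralDomain A φ,
      Integrable (fun r => |φ r| + C) (spectralMeasure A w) := fun w hw =>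
    ((MemLp.integrable one_le_two hw).abs).add (integrable_const C)
  -- A single majorant serves all four spectral measures of the pairing.
  have hgint : Integrable (fun r => |φ r| + C)
      (2 • (spectralMeasure A u + spectralMeasure A v)) := by
    rw [two_smul]
    exact ((hint u hu).add_measure (hint v hv)).add_measure
      ((hint u hu).add_measure (hint v hv))
  have hconv : ∀ w, spectralMeasure A w ≤ 2 • (spectralMeasure A u + spectralMeasure A v) →
      Tendsto (fun n => ((∫ r, f n r ∂(spectralMeasure A w) : ℝ) : ℂ)) atTop
        (𝓝 ((∫ r, φ r ∂(spectralMeasure A w) : ℝ) : ℂ)) := fun w hw =>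
    (Complex.continuous_ofReal.tendsto _).comp <|
      tendsto_integral_of_dominated_convergence (fun r => |φ r| + C)
        (fun n => (hf n).aestronglyMeasurable) (hgint.mono_measure hw)
        (fun n => (hbound w).mono fun r h => h n) (hlim w)
  have hp : Tendsto (fun n => spectralPairing A (f n) u v) atTop
      (𝓝 (spectralPairing A φ u v)) := by
    have h1 := spectralMeasure_add_le A u (Complex.I • v)
    have h2 := spectralMeasure_sub_le A u (Complex.I • v)
    rw [spectralMeasure_I_smul] at h1 h2
    simp only [spectralPairing]
    exact ((((hconv _ (spectralMeasure_add_le A u v)).sub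
      (hconv _ (spectralMeasure_sub_le A u v))).add ((hconv _ h1).const_mul Complex.I)).sub
      ((hconv _ h2).const_mul Complex.I)).div_const 4
  have hq : Tendsto (fun n => spectralPairing A (f n) u v) atTop (𝓝 ⟪v, z⟫_ℂ) := by
    simp only [spectralPairing_eq_inner A u v (hf _)]
    exact tendsto_const_nhds.inner hz
  exact tendsto_nhds_unique hq hp

theorem cfc_one_sub_pow (A : H →L[ℂ] H) (hA : IsSelfAdjoint A) (n : ℕ) :
    cfc (fun r : ℝ => (1 - r) ^ n) A = (1 - A) ^ n := by
  rw [cfc_pow (fun r : ℝ => 1 - r) n A (by fun_prop),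
    cfc_sub (fun _ : ℝ => 1) (fun r : ℝ => r) A (by fun_prop) (by fun_prop),
    cfc_const_one ℝ A, cfc_id' ℝ A]

/-- If the powers of `1 - A` tend strongly to `0` at `w`, then `E_{w,w}` is carried by `(0, 2)`. -/
theorem ae_spectralMeasure_abs_one_sub_lt (A : H →L[ℂ] H) (hA : IsSelfAdjoint A) (w : H)
    (h : Tendsto (fun n : ℕ => ((1 - A) ^ n) w) atTop (𝓝 0)) :
    ∀ᵐ r ∂(spectralMeasure A w), |1 - r| < 1 := by
  set s : Set ℝ := {r | 1 ≤ |1 - r|} with hs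
  have hsm : MeasurableSet s :=
    measurableSet_le measurable_const (by fun_prop)
  have hcfc := cfc_one_sub_pow A hA
  -- Chebyshev: (1 - r)^(2n) is at least 1 on `s`, and its integral is the squared norm.
  have hle : ∀ n : ℕ, (spectralMeasure A w).real s ≤ ‖((1 - A) ^ n) w‖ ^ 2 := by
    intro n
    rw [← hcfc n, ← integral_sq_spectralMeasure A w (by fun_prop), ← integral_indicator_one hsm]
    refine integral_mono ((integrable_const 1).indicator hsm)
      (integrable_spectralMeasure A w (by fun_prop)) fun r => ?_
    by_cases hr : r ∈ s
    · rw [Set.indicator_of_mem hr]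
      change 1 ≤ ((1 - r) ^ n) ^ 2
      rw [← pow_mul, mul_comm, pow_mul, ← sq_abs]
      exact one_le_pow₀ (one_le_pow₀ hr)
    · rw [Set.indicator_of_notMem hr]
      positivity
  have h0 : (spectralMeasure A w).real s ≤ 0 := by
    refine ge_of_tendsto' (x := atTop) ?_ hle
    simpa using (h.norm).pow 2
  have h1 : spectralMeasure A w s = 0 :=
    (measureReal_eq_zero_iff).1 (le_antisymm h0 measureReal_nonneg)
  refine measure_mono_null (fun r hr => ?_) h1
  exact not_lt.1 (show ¬ |1 - r| < 1 from hr)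

end SpectralMeasure

/-! ### Power series of the logarithm and of fractional powers -/

section BinomialCoefficients

/-- The coefficients of the expansion
`(1 - t)^s = 1 - s ∑ₙ binomialFactor s n / (n + 1) * t^(n + 1)`. -/
def binomialFactor (s : ℝ) (n : ℕ) : ℝ := ∏ k ∈ Finset.range n, (1 - s / (k + 1))

theorem binomialFactor_nonneg {s : ℝ} (hs : s ≤ 1) (n : ℕ) : 0 ≤ binomialFactor s n := by
  refine Finset.prod_nonneg fun k _ => sub_nonneg.2 ?_
  rw [div_le_one (by positivity)]
  have : (0 : ℝ) ≤ k := k.cast_nonneg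
  linarith

theorem binomialFactor_le_one {s : ℝ} (hs0 : 0 ≤ s) (hs : s ≤ 1) (n : ℕ) :
    binomialFactor s n ≤ 1 := by
  refine Finset.prod_le_one (fun k _ => sub_nonneg.2 ?_) fun k _ => sub_le_self _ (by positivity)
  rw [div_le_one (by positivity)]
  have : (0 : ℝ) ≤ k := k.cast_nonneg
  linarith

theorem tendsto_binomialFactor (n : ℕ) :
    Tendsto (fun s => binomialFactor s n) (𝓝[>] 0) (𝓝 1) := by
  have hc : Continuous fun s => binomialFactor s n := by
    unfold binomialFactor
    fun_prop
  have h := hc.tendsto 0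
  have h0 : binomialFactor 0 n = 1 := by simp [binomialFactor]
  rw [h0] at h
  exact h.mono_left nhdsWithin_le_nhds

/-- Each factor s - k with k ≥ 1 of the falling factorial equals -k(1 - s/k), which absorbs one sign
and one factor of the factorial; the factor s and the quotient n!/(n+1)! remain. -/
theorem ring_choose_succ_mul_neg_one_pow (s : ℝ) (n : ℕ) :
    Ring.choose s (n + 1) * (-1) ^ (n + 1) = -(s * (binomialFactor s n / (n + 1))) := by
  have key : ∀ n : ℕ, (descPochhammer ℤ (n + 1)).smeval s * (-1) ^ (n + 1)
      = -(s * (n.factorial * binomialFactor s n)) := by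
    intro n
    induction n with
    | zero => simp [binomialFactor]
    | succ n ih =>
      rw [descPochhammer_succ_right, Polynomial.smeval_mul, pow_succ]
      have h1 : (Polynomial.X - ((n + 1 : ℕ) : Polynomial ℤ)).smeval s = s - (n + 1) := by
        simp [Polynomial.smeval_sub, Polynomial.smeval_natCast]
      have h2 : binomialFactor s (n + 1) = binomialFactor s n * (1 - s / (n + 1)) :=
        Finset.prod_range_succ _ _
      rw [h1, h2, Nat.factorial_succ]
      have h3 : ((n : ℝ) + 1) ≠ 0 := by positivity
      calc (descPochhammer ℤ (n + 1)).smeval s * (s - (n + 1)) * ((-1) ^ (n + 1) * -1)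
          = ((descPochhammer ℤ (n + 1)).smeval s * (-1) ^ (n + 1)) * (n + 1 - s) := by ring
        _ = _ := by
          rw [ih]
          push_cast
          field_simp
  have h := Ring.descPochhammer_eq_factorial_smul_choose s (n + 1)
  have hk := key n
  rw [h, nsmul_eq_mul, Nat.factorial_succ] at hk
  have hn : (n.factorial : ℝ) ≠ 0 := by positivity
  have hn' : ((n : ℝ) + 1) ≠ 0 := by positivity
  push_cast at hk
  field_simp
  have : (n.factorial : ℝ) * (Ring.choose s (n + 1) * (-1) ^ (n + 1) * (n + 1))
      = n.factorial * (-(s * binomialFactor s n)) := by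
    linear_combination hk
  exact mul_left_cancel₀ hn this

theorem hasSum_one_sub_rpow (s : ℝ) {t : ℝ} (ht : |t| < 1) :
    HasSum (fun n : ℕ => s * (binomialFactor s n / (n + 1)) * t ^ (n + 1))
      (1 - (1 - t) ^ s) := by
  have h := (Real.one_add_rpow_hasFPowerSeriesOnBall_zero (a := s)).hasSum (y := -t) (by
    rw [Metric.mem_eball, edist_zero_right, enorm_neg, ← ofReal_norm,
      ENNReal.ofReal_lt_one]
    exact ht)
  simp only [binomialSeries_apply, List.ofFn_const, List.prod_replicate, zero_add,
    smul_eq_mul] at h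
  have h1 := ((hasSum_nat_add_iff' 1).2 h).neg
  simp only [Finset.range_one, Finset.sum_singleton, Ring.choose_zero_right, pow_zero,
    mul_one] at h1
  have h2 : (fun n : ℕ => s * (binomialFactor s n / (n + 1)) * t ^ (n + 1))
      = fun n : ℕ => -(Ring.choose s (n + 1) * (-t) ^ (n + 1)) := by
    ext n
    rw [neg_pow, ← mul_assoc, ring_choose_succ_mul_neg_one_pow s n]
    ring
  have h3 : 1 - (1 - t) ^ s = -((1 + -t) ^ s - 1) := by
    rw [← sub_eq_add_neg]
    ring
  rwa [h2, h3]

/-- Splitting off `f 0` leaves minus the alternating sum of the shifted sequence; hence the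
induction runs over all `f` at once. -/
theorem alternating_sum_mem_Icc (N : ℕ) : ∀ f : ℕ → ℝ, Antitone f → (∀ n, 0 ≤ f n) →
    ∑ i ∈ Finset.range N, (-1) ^ i * f i ∈ Set.Icc 0 (f 0) := by
  induction N with
  | zero => intro f _ h0; simpa using h0 0
  | succ N ih =>
    intro f hf h0
    have h := ih (fun n => f (n + 1)) (fun a b hab => hf (by omega)) fun n => h0 _
    have h1 : f (0 + 1) ≤ f 0 := hf (by omega)
    rw [Finset.sum_range_succ']
    have h2 : ∑ i ∈ Finset.range N, (-1 : ℝ) ^ (i + 1) * f (i + 1)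
        = -∑ i ∈ Finset.range N, (-1 : ℝ) ^ i * f (i + 1) := by
      rw [← Finset.sum_neg_distrib]
      exact Finset.sum_congr rfl fun i _ => by ring
    rw [h2]
    obtain ⟨h3, h4⟩ := h
    constructor <;> simp only [pow_zero, one_mul] <;> linarith

/-- For t ≥ 0 the terms are nonnegative and the full sum dominates; for t ≤ 0 the sum alternates and
is at most its first term |t| < 1. The bound is uniform in N, as dominated convergence needs. -/
theorem abs_sum_pow_div_le {t : ℝ} (ht : |t| < 1) (N : ℕ) :
    |∑ n ∈ Finset.range N, t ^ (n + 1) / (n + 1)| ≤ |Real.log (1 - t)| + 1 := by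
  have hs := Real.hasSum_pow_div_log_of_abs_lt_one ht
  rcases le_total 0 t with h0 | h0
  · have h1 : ∀ n : ℕ, 0 ≤ t ^ (n + 1) / ((n : ℝ) + 1) := fun n => by positivity
    rw [abs_of_nonneg (Finset.sum_nonneg fun n _ => h1 n)]
    have h2 := sum_le_hasSum (Finset.range N) (fun n _ => h1 n) hs
    have h3 := neg_le_abs (Real.log (1 - t))
    linarith
  · obtain ⟨τ, rfl⟩ : ∃ τ, t = -τ := ⟨-t, by ring⟩
    have hτ : 0 ≤ τ := by linarith
    rw [abs_neg, abs_of_nonneg hτ] at ht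
    have h := alternating_sum_mem_Icc N (fun n => τ ^ (n + 1) / (n + 1)) (fun a b hab => by
      have : (a : ℝ) ≤ b := by exact_mod_cast hab
      have h1 : τ ^ (b + 1) ≤ τ ^ (a + 1) := pow_le_pow_of_le_one hτ ht.le (by omega)
      dsimp only
      gcongr) fun n => by positivity
    have h2 : ∑ n ∈ Finset.range N, (-τ) ^ (n + 1) / ((n : ℝ) + 1)
        = -∑ n ∈ Finset.range N, (-1) ^ n * (τ ^ (n + 1) / ((n : ℝ) + 1)) := by
      rw [← Finset.sum_neg_distrib]
      exact Finset.sum_congr rfl fun i _ => by rw [neg_pow]; ring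
    rw [h2, abs_neg, abs_of_nonneg h.1]
    have h3 := h.2
    simp only [zero_add, pow_one, CharP.cast_eq_zero, div_one] at h3
    have := abs_nonneg (Real.log (1 - -τ))
    linarith

/-- The coefficients are nonnegative for s ≤ 1, so the full series at |t| dominates. -/
theorem abs_sum_binomialFactor_le {s t : ℝ} (hs0 : 0 < s) (hs : s ≤ 1) (ht : |t| < 1) (N : ℕ) :
    |∑ n ∈ Finset.range N, s * (binomialFactor s n / (n + 1)) * t ^ (n + 1)| ≤ 1 := by
  have hsum := hasSum_one_sub_rpow s (t := |t|) (by rwa [abs_abs])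
  have h0 : ∀ n : ℕ, 0 ≤ s * (binomialFactor s n / (n + 1)) := fun n => by
    have := binomialFactor_nonneg hs n
    positivity
  calc |∑ n ∈ Finset.range N, s * (binomialFactor s n / (n + 1)) * t ^ (n + 1)|
      ≤ ∑ n ∈ Finset.range N, |s * (binomialFactor s n / (n + 1)) * t ^ (n + 1)| :=
        Finset.abs_sum_le_sum_abs _ _
    _ = ∑ n ∈ Finset.range N, s * (binomialFactor s n / (n + 1)) * |t| ^ (n + 1) :=
        Finset.sum_congr rfl fun n _ => by rw [abs_mul, abs_of_nonneg (h0 n), abs_pow]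
    _ ≤ 1 - (1 - |t|) ^ s :=
        sum_le_hasSum _ (fun n _ => mul_nonneg (h0 n) (by positivity)) hsum
    _ ≤ 1 := sub_le_self _ (Real.rpow_nonneg (by linarith) _)

end BinomialCoefficients

/-! ### Spectral integrals as series in the powers of `1 - A` -/

section SpectralSeries

variable {H : Type*} [NormedAddCommGroup H] [InnerProductSpace ℂ H] [CompleteSpace H]

theorem cfc_one_sub_pow_sum (A : H →L[ℂ] H) (hA : IsSelfAdjoint A) (a : ℝ) (c : ℕ → ℝ) (N : ℕ) :
    cfc (fun r : ℝ => a + ∑ n ∈ Finset.range N, c n * (1 - r) ^ (n + 1)) A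
      = a • 1 + ∑ n ∈ Finset.range N, c n • (1 - A) ^ (n + 1) := by
  have hcfc := cfc_one_sub_pow A hA
  induction N with
  | zero => simp [cfc_const a A, Algebra.algebraMap_eq_smul_one]
  | succ N ih =>
    simp only [Finset.sum_range_succ, ← add_assoc]
    rw [cfc_add A (fun r : ℝ => a + ∑ n ∈ Finset.range N, c n * (1 - r) ^ (n + 1))
      (fun r => c N * (1 - r) ^ (N + 1)) (by fun_prop) (by fun_prop), ih,
      cfc_const_mul (c N) (fun r : ℝ => (1 - r) ^ (N + 1)) A (by fun_prop), hcfc]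

/-- Expansion of `φ(A) u` into the powers of `1 - A`. -/
theorem isSpectralValue_of_series (A : H →L[ℂ] H) (hA : IsSelfAdjoint A)
    (hpow : ∀ w, Tendsto (fun n : ℕ => ((1 - A) ^ n) w) atTop (𝓝 0))
    {φ : ℝ → ℝ} {a C : ℝ} {c : ℕ → ℝ}
    (hsum : ∀ t : ℝ, |t| < 1 → Tendsto
      (fun N => a + ∑ n ∈ Finset.range N, c n * t ^ (n + 1)) atTop (𝓝 (φ (1 - t))))
    (hbound : ∀ t : ℝ, |t| < 1 → ∀ N,
      |a + ∑ n ∈ Finset.range N, c n * t ^ (n + 1)| ≤ |φ (1 - t)| + C)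
    {u z : H} (hz : Tendsto
      (fun N => a • u + ∑ n ∈ Finset.range N, c n • ((1 - A) ^ (n + 1)) u) atTop (𝓝 z)) :
    IsSpectralValue A φ u z := by
  refine isSpectralValue_of_tendsto A (C := C)
    (f := fun N r => a + ∑ n ∈ Finset.range N, c n * (1 - r) ^ (n + 1))
    (fun N => by fun_prop) (fun w => ?_) (fun w => ?_) ?_
  · filter_upwards [ae_spectralMeasure_abs_one_sub_lt A hA w (hpow w)] with r hr
    simpa using hsum _ hr
  · filter_upwards [ae_spectralMeasure_abs_one_sub_lt A hA w (hpow w)] with r hr N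
    simpa using hbound _ hr N
  · simpa [cfc_one_sub_pow_sum A hA, sum_apply] using hz

theorem isSpectralValue_log (A : H →L[ℂ] H) (hA : IsSelfAdjoint A)
    (hpow : ∀ w, Tendsto (fun n : ℕ => ((1 - A) ^ n) w) atTop (𝓝 0)) {u z : H}
    (hz : Tendsto (fun N => ∑ n ∈ Finset.range N, (-1 / (n + 1) : ℝ) • ((1 - A) ^ (n + 1)) u)
      atTop (𝓝 z)) :
    IsSpectralValue A Real.log u z := by
  have heq : ∀ (t : ℝ) (N : ℕ), (0 : ℝ) + ∑ n ∈ Finset.range N, (-1 / (n + 1) : ℝ) * t ^ (n + 1)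
      = -∑ n ∈ Finset.range N, t ^ (n + 1) / (n + 1) := fun t N => by
    rw [zero_add, ← Finset.sum_neg_distrib]
    exact Finset.sum_congr rfl fun n _ => by ring
  refine isSpectralValue_of_series A hA hpow (a := 0) (C := 1)
    (c := fun n => -1 / (n + 1)) (fun t ht => ?_) (fun t ht N => ?_) (by simpa using hz)
  · simp only [heq]
    simpa using (Real.hasSum_pow_div_log_of_abs_lt_one ht).tendsto_sum_nat.neg
  · rw [heq, abs_neg]
    exact abs_sum_pow_div_le ht N

theorem isSpectralValue_rpow (A : H →L[ℂ] H) (hA : IsSelfAdjoint A)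
    (hpow : ∀ w, Tendsto (fun n : ℕ => ((1 - A) ^ n) w) atTop (𝓝 0)) {s : ℝ} (hs0 : 0 < s)
    (hs : s ≤ 1) {u z : H}
    (hz : Tendsto (fun N => u + ∑ n ∈ Finset.range N,
      (-(s * (binomialFactor s n / (n + 1)))) • ((1 - A) ^ (n + 1)) u) atTop (𝓝 z)) :
    IsSpectralValue A (fun r => r ^ s) u z := by
  have heq : ∀ (t : ℝ) (N : ℕ),
      1 + ∑ n ∈ Finset.range N, -(s * (binomialFactor s n / (n + 1))) * t ^ (n + 1)
      = 1 - ∑ n ∈ Finset.range N, s * (binomialFactor s n / (n + 1)) * t ^ (n + 1) := fun t N => by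
    rw [sub_eq_add_neg, ← Finset.sum_neg_distrib]
    exact congrArg _ (Finset.sum_congr rfl fun n _ => by ring)
  refine isSpectralValue_of_series A hA hpow (a := 1) (C := 2)
    (c := fun n => -(s * (binomialFactor s n / (n + 1)))) (fun t ht => ?_) (fun t ht N => ?_)
    (by simpa using hz)
  · simp only [heq]
    simpa using (hasSum_one_sub_rpow s ht).tendsto_sum_nat.const_sub 1
  · rw [heq]
    have h1 := abs_le.1 (abs_sum_binomialFactor_le hs0 hs ht N)
    have h2 := abs_nonneg ((1 - t) ^ s)
    rw [abs_le]
    constructor <;> linarith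

end SpectralSeries

/-! ### The transition operator, its energy, and interpolation of norms -/

namespace WeightedGraph

variable {V : Type*} (G : WeightedGraph V)

/-- The transition operator `(Pf)(x) = (1/μ(x)) ∑_y w_{xy} f(y)` of the random walk. -/
def walk (f : V → ℝ) (x : V) : ℝ := (G.degree x)⁻¹ * ∑' y, G.w x y * f y

/-- The graph is locally finite. -/
def LocallyFinite : Prop := ∀ x, (G.w x).support.Finite

variable {G}

theorem degree_nonneg (x : V) : 0 ≤ G.degree x := tsum_nonneg (G.nonneg x)

theorem LocallyFinite.summable_mul (h : G.LocallyFinite) (x : V) (f : V → ℝ) :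
    Summable fun y => G.w x y * f y :=
  summable_of_hasFiniteSupport ((h x).subset (Function.support_mul_subset_left _ _))

theorem LocallyFinite.walk_support_finite (h : G.LocallyFinite) {f : V → ℝ}
    (hf : f.support.Finite) : (G.walk f).support.Finite := by
  refine (hf.biUnion fun y _ => h y).subset fun x hx => ?_
  by_contra hc
  refine hx ?_
  have : ∀ y, G.w x y * f y = 0 := by
    intro y
    by_contra hy
    refine hc (Set.mem_biUnion (x := y) (right_ne_zero_of_mul hy) ?_)
    rw [Function.mem_support, G.symm]
    exact left_ne_zero_of_mul hy
  simp [walk, this]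

theorem LocallyFinite.walk_iterate_support_finite (h : G.LocallyFinite) {f : V → ℝ}
    (hf : f.support.Finite) (n : ℕ) : (G.walk^[n] f).support.Finite := by
  induction n with
  | zero => exact hf
  | succ n ih =>
    rw [Function.iterate_succ_apply']
    exact h.walk_support_finite ih

theorem degree_mul_walk {x : V} (hx : 0 < G.degree x) (f : V → ℝ) :
    G.degree x * G.walk f x = ∑' y, G.w x y * f y :=
  mul_inv_cancel_left₀ hx.ne' _

theorem summable_degree_mul {f : V → ℝ} (hf : f.support.Finite) :
    Summable fun x => G.degree x * f x :=
  summable_of_hasFiniteSupport (hf.subset (Function.support_mul_subset_right _ _))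

/-- Reversibility: by symmetry of the weights the vertex measure is invariant. Local finiteness
makes the interchanged double sum finite. -/
theorem LocallyFinite.tsum_degree_mul_walk (h : G.LocallyFinite) (hdeg : ∀ x, 0 < G.degree x)
    {f : V → ℝ} (hf : f.support.Finite) :
    ∑' x, G.degree x * G.walk f x = ∑' x, G.degree x * f x := by
  have hsum : Summable (Function.uncurry fun x y => G.w x y * f y) := by
    refine summable_of_hasFiniteSupport
      ((hf.biUnion fun y _ => (h y).prod (Set.finite_singleton y)).subset ?_)
    rintro ⟨x, y⟩ hxy
    refine Set.mem_biUnion (x := y) (right_ne_zero_of_mul hxy) ⟨?_, rfl⟩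
    rw [Function.mem_support, G.symm]
    exact left_ne_zero_of_mul hxy
  calc ∑' x, G.degree x * G.walk f x = ∑' x, ∑' y, G.w x y * f y :=
        tsum_congr fun x => degree_mul_walk (hdeg x) f
    _ = ∑' y, ∑' x, G.w x y * f y := hsum.tsum_comm.symm
    _ = ∑' y, G.degree y * f y := tsum_congr fun y => by
        rw [tsum_mul_right, degree]
        simp only [G.symm y]

theorem LocallyFinite.abs_walk_le (h : G.LocallyFinite) (f : V → ℝ) (x : V) :
    |G.walk f x| ≤ G.walk (fun y => |f y|) x := by
  rw [walk, abs_mul, abs_of_nonneg (inv_nonneg.2 (degree_nonneg x))]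
  refine mul_le_mul_of_nonneg_left ?_ (inv_nonneg.2 (degree_nonneg x))
  have h1 : ∀ y, ‖G.w x y * f y‖ = G.w x y * |f y| := fun y => by
    rw [Real.norm_eq_abs, abs_mul, abs_of_nonneg (G.nonneg x y)]
  have h2 := norm_tsum_le_tsum_norm (h.summable_mul x f).norm
  simpa only [h1, Real.norm_eq_abs] using h2

theorem support_abs_finite {f : V → ℝ} (hf : f.support.Finite) :
    (fun x => |f x|).support.Finite := by
  refine hf.subset fun x hx => ?_
  simpa using hx

theorem support_sq_finite {f : V → ℝ} (hf : f.support.Finite) :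
    (fun x => f x ^ 2).support.Finite := by
  refine hf.subset fun x hx => ?_
  simpa using hx

/-- The transition operator is a contraction of `ℓ¹(V, μ)`. -/
theorem LocallyFinite.tsum_degree_mul_abs_walk_le (h : G.LocallyFinite)
    (hdeg : ∀ x, 0 < G.degree x) {f : V → ℝ} (hf : f.support.Finite) :
    ∑' x, G.degree x * |G.walk f x| ≤ ∑' x, G.degree x * |f x| := by
  rw [← h.tsum_degree_mul_walk hdeg (support_abs_finite hf)]
  refine (summable_degree_mul (support_abs_finite (h.walk_support_finite hf))).tsum_le_tsum
    (fun x => mul_le_mul_of_nonneg_left (h.abs_walk_le f x) (degree_nonneg x))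
    (summable_degree_mul (h.walk_support_finite (support_abs_finite hf)))

theorem LocallyFinite.tsum_degree_mul_abs_walk_iterate_le (h : G.LocallyFinite)
    (hdeg : ∀ x, 0 < G.degree x) {f : V → ℝ} (hf : f.support.Finite) (n : ℕ) :
    ∑' x, G.degree x * |G.walk^[n] f x| ≤ ∑' x, G.degree x * |f x| := by
  induction n with
  | zero => exact le_rfl
  | succ n ih =>
    rw [Function.iterate_succ_apply']
    exact (h.tsum_degree_mul_abs_walk_le hdeg (h.walk_iterate_support_finite hf n)).trans ih

/-- The variance of `f` under the transition probabilities from `z`. -/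
theorem LocallyFinite.degree_mul_variance (h : G.LocallyFinite) {z : V} (hz : 0 < G.degree z)
    (f : V → ℝ) :
    G.degree z * (G.walk (fun y => f y ^ 2) z - G.walk f z ^ 2)
      = ∑' y, G.w z y * (f y - G.walk f z) ^ 2 := by
  have h1 := degree_mul_walk hz f
  have h2 := degree_mul_walk hz fun y => f y ^ 2
  set m := G.walk f z
  have h3 : ∀ y, G.w z y * (f y - m) ^ 2
      = (G.w z y * f y ^ 2 - G.w z y * f y * (2 * m)) + G.w z y * m ^ 2 := fun y => by ring
  simp only [h3]
  rw [((h.summable_mul z _).sub ((h.summable_mul z _).mul_right _)).tsum_add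
      ((G.summable z).mul_right _),
    (h.summable_mul z _).tsum_sub ((h.summable_mul z _).mul_right _), tsum_mul_right,
    tsum_mul_right, ← h1, ← h2]
  change _ = _ + G.degree z * m ^ 2
  ring

/-- Only the two neighbours a, b are kept in the variance, and p² + q² ≥ (p - q)²/2. -/
theorem LocallyFinite.le_degree_mul_variance (h : G.LocallyFinite) {z a b : V}
    (hz : 0 < G.degree z) (hab : a ≠ b) {c : ℝ} (ha : c ≤ G.w z a) (hb : c ≤ G.w z b)
    (hc : 0 ≤ c) (f : V → ℝ) :
    c / 2 * (f a - f b) ^ 2 ≤ G.degree z * (G.walk (fun y => f y ^ 2) z - G.walk f z ^ 2) := by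
  classical
  rw [h.degree_mul_variance hz]
  set m := G.walk f z
  have h1 := (h.summable_mul z fun y => (f y - m) ^ 2).sum_le_tsum {a, b}
    fun y _ => mul_nonneg (G.nonneg z y) (sq_nonneg _)
  rw [Finset.sum_pair hab] at h1
  refine le_trans ?_ h1
  have h2 := mul_le_mul_of_nonneg_right ha (sq_nonneg (f a - m))
  have h3 := mul_le_mul_of_nonneg_right hb (sq_nonneg (f b - m))
  have h4 : 0 ≤ c * ((f a - m) + (f b - m)) ^ 2 := mul_nonneg hc (sq_nonneg _)
  linarith

/-- Lower bound of the energy of the two-step walk. -/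
theorem LocallyFinite.le_tsum_sq_sub_tsum_walk_sq (h : G.LocallyFinite)
    (hdeg : ∀ x, 0 < G.degree x) {c : ℝ} (hc : 0 ≤ c) {σ τ : V → V} (hστ : ∀ z, σ z ≠ τ z)
    (hσ : ∀ z, c ≤ G.w z (σ z)) (hτ : ∀ z, c ≤ G.w z (τ z)) {f : V → ℝ}
    (hf : f.support.Finite) (hsum : Summable fun z => (f (σ z) - f (τ z)) ^ 2) :
    c / 2 * ∑' z, (f (σ z) - f (τ z)) ^ 2
      ≤ ∑' x, G.degree x * f x ^ 2 - ∑' x, G.degree x * G.walk f x ^ 2 := by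
  have h1 := summable_degree_mul (G := G) (h.walk_support_finite (support_sq_finite hf))
  have h2 := summable_degree_mul (G := G) (support_sq_finite (h.walk_support_finite hf))
  -- Invariance replaces f² by P(f²), so the difference becomes a sum of variances.
  rw [← h.tsum_degree_mul_walk hdeg (support_sq_finite hf), ← h1.tsum_sub h2, ← tsum_mul_left]
  refine (hsum.mul_left _).tsum_le_tsum (fun z => ?_) (h1.sub h2)
  rw [← mul_sub]
  exact h.le_degree_mul_variance (hdeg z) (hστ z) (hσ z) (hτ z) hc f

section Measure

variable [MeasurableSpace V]

theorem finite_of_vertexMeasure_lt_top {c : ℝ} (hc : 0 < c) (hdeg : ∀ x, c ≤ G.degree x)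
    {s : Set V} (hsm : MeasurableSet s) (hs : G.vertexMeasure s < ∞) : s.Finite := by
  by_contra hinf
  have h1 : ENNReal.ofReal c * Measure.count s ≤ G.vertexMeasure s := by
    rw [vertexMeasure, Measure.sum_apply _ hsm, Measure.count, Measure.sum_apply _ hsm,
      ← ENNReal.tsum_mul_left]
    exact ENNReal.tsum_le_tsum fun x => mul_le_mul_left (ENNReal.ofReal_le_ofReal (hdeg x)) _
  rw [Measure.count_apply_infinite hinf, ENNReal.mul_top (by simpa using hc)] at h1
  exact h1.not_gt hs

variable [MeasurableSingletonClass V]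

/-- Every point has positive mass, so the only null set is empty. -/
theorem eq_of_ae_vertexMeasure (hdeg : ∀ x, 0 < G.degree x) {p : V → Prop}
    (hp : ∀ᵐ x ∂G.vertexMeasure, p x) (x : V) : p x := by
  by_contra hx
  have h1 : G.vertexMeasure {x} = 0 := measure_mono_null (by simpa using hx) hp
  rw [vertexMeasure_singleton, ENNReal.ofReal_eq_zero] at h1
  exact h1.not_gt (hdeg x)

theorem eLpNorm_one_vertexMeasure {f : V → ℝ} (hf : f.support.Finite) :
    eLpNorm f 1 G.vertexMeasure = ENNReal.ofReal (∑' x, G.degree x * |f x|) := by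
  rw [eLpNorm_one_eq_lintegral_enorm, vertexMeasure, lintegral_sum_measure,
    ENNReal.ofReal_tsum_of_nonneg (fun x => mul_nonneg (degree_nonneg x) (abs_nonneg _))
      (summable_degree_mul (support_abs_finite hf))]
  refine tsum_congr fun x => ?_
  rw [lintegral_smul_measure, lintegral_dirac, smul_eq_mul, ENNReal.ofReal_mul (degree_nonneg x),
    Real.enorm_eq_ofReal_abs]

end Measure

end WeightedGraph

/-- Interpolation between `L¹` and `L^∞`. -/
theorem eLpNorm_le_of_bound_of_eLpNorm_one_le {α : Type*} [MeasurableSpace α] {μ : Measure α}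
    {f : α → ℝ} {M K : ℝ} (hM0 : 0 ≤ M) (hK0 : 0 ≤ K) (hM : ∀ x, |f x| ≤ M)
    (hK : eLpNorm f 1 μ ≤ ENNReal.ofReal K) {p : ℝ≥0∞} (hp : 1 ≤ p) :
    eLpNorm f p μ ≤ ENNReal.ofReal (M ^ (1 - 1 / p.toReal) * K ^ (1 / p.toReal)) := by
  rcases eq_or_ne p ∞ with rfl | hp'
  -- Here `p.toReal = 0` and `1 / 0 = 0`, so the claimed bound is just M.
  · simp only [ENNReal.toReal_top, div_zero, sub_zero, Real.rpow_one, Real.rpow_zero, mul_one]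
    rw [eLpNorm_exponent_top]
    refine eLpNormEssSup_le_of_ae_bound (Eventually.of_forall hM)
  · have hp0 : p ≠ 0 := (zero_lt_one.trans_le hp).ne'
    have hr : 1 ≤ p.toReal := by
      rw [← ENNReal.toReal_one]
      exact (ENNReal.toReal_le_toReal ENNReal.one_ne_top hp').2 hp
    have hr0 : 0 < p.toReal := zero_lt_one.trans_le hr
    rw [eLpNorm_eq_lintegral_rpow_enorm_toReal hp0 hp']
    -- Pointwise |f|^p ≤ M^(p-1) |f|.
    have h1 : ∫⁻ x, ‖f x‖ₑ ^ p.toReal ∂μ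
        ≤ ENNReal.ofReal M ^ (p.toReal - 1) * ENNReal.ofReal K := by
      refine le_trans ?_ (mul_le_mul_right hK _)
      rw [eLpNorm_one_eq_lintegral_enorm, ← lintegral_const_mul' _ _
        (ENNReal.rpow_ne_top_of_nonneg (by linarith) ENNReal.ofReal_ne_top)]
      refine lintegral_mono fun x => ?_
      have h2 : ‖f x‖ₑ ^ p.toReal = ‖f x‖ₑ ^ (p.toReal - 1) * ‖f x‖ₑ := by
        conv_rhs => rw [← ENNReal.rpow_one ‖f x‖ₑ, ← ENNReal.rpow_mul,
          ← ENNReal.rpow_add_of_nonneg _ _ (by linarith) zero_le_one]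
        ring_nf
      rw [h2]
      refine mul_le_mul_left (ENNReal.rpow_le_rpow ?_ (by linarith)) _
      rw [Real.enorm_eq_ofReal_abs]
      exact ENNReal.ofReal_le_ofReal (hM x)
    refine (ENNReal.rpow_le_rpow h1 (by positivity)).trans_eq ?_
    rw [ENNReal.mul_rpow_of_nonneg _ _ (by positivity), ← ENNReal.rpow_mul,
      ENNReal.ofReal_mul (by positivity), ← ENNReal.ofReal_rpow_of_nonneg hM0 (by
        rw [sub_nonneg, div_le_one hr0]; exact hr),
      ← ENNReal.ofReal_rpow_of_nonneg hK0 (by positivity)]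
    congr 2
    field_simp

/-! ### A one-dimensional Sobolev inequality and a decay recursion -/

section Nash

theorem nsmul_left_injective_of_ne_zero {V : Type*} [AddCommGroup V] [IsAddTorsionFree V] {e : V}
    (he : e ≠ 0) : Function.Injective fun k : ℕ => k • e := by
  intro k l hkl
  have h : (k : ℤ) • e = (l : ℤ) • e := by simpa only [natCast_zsmul] using hkl
  exact_mod_cast smul_left_injective ℤ he h

theorem add_ne_sub_of_ne_zero {V : Type*} [AddCommGroup V] [IsAddTorsionFree V] {e : V}
    (he : e ≠ 0) (z : V) : z + e ≠ z - e := by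
  intro hz
  rw [sub_eq_add_neg] at hz
  exact he (self_eq_neg.1 (add_left_cancel hz))

theorem summable_sq_sub_shift {V : Type*} [AddCommGroup V] {f : V → ℝ} (e : V)
    (hf : Summable fun z => f z ^ 2) : Summable fun z => (f (z + e) - f (z - e)) ^ 2 := by
  refine (((hf.comp_injective (add_left_injective e)).mul_left 2).add
    ((hf.comp_injective (sub_left_injective (b := e))).mul_left 2)).of_nonneg_of_le
    (fun z => sq_nonneg _) fun z => ?_
  simp only [Function.comp]
  linarith [sq_nonneg (f (z + e) + f (z - e))]

/-- A one-dimensional Sobolev inequality along the lines with direction `2 • e`. -/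
theorem pow_four_le_of_finite_support {V : Type*} [AddCommGroup V] [IsAddTorsionFree V] {e : V}
    (he : e ≠ 0) {f : V → ℝ} (hf : f.support.Finite) (x : V) :
    f x ^ 4 ≤ 4 * (∑' z, (f (z + e) - f (z - e)) ^ 2) * ∑' z, f z ^ 2 := by
  classical
  have hinj : Function.Injective fun k : ℕ => x + (2 * k) • e := by
    intro k l hkl
    have h1 : (fun k : ℕ => k • e) (2 * k) = (fun k : ℕ => k • e) (2 * l) := add_left_cancel hkl
    have := nsmul_left_injective_of_ne_zero he h1
    omega
  have hsq : Summable fun z => f z ^ 2 :=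
    summable_of_hasFiniteSupport (hf.subset fun z hz => by simpa using hz)
  have hD := summable_sq_sub_shift e hsq
  -- The points x + 2k e are distinct, so they leave the finite support.
  obtain ⟨N, hN⟩ : ∃ N : ℕ, f (x + (2 * N) • e) = 0 := by
    by_contra! h
    exact Set.infinite_range_of_injective hinj
      (hf.subset (by rintro _ ⟨k, rfl⟩; exact h k))
  set g : ℕ → ℝ := fun k => f (x + (2 * k) • e) with hg
  -- Telescoping of g² down to the zero g N; Cauchy–Schwarz then separates differences from sums.
  have htel : f x ^ 2 = ∑ k ∈ Finset.range N, (g k - g (k + 1)) * (g k + g (k + 1)) := by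
    have h1 := Finset.sum_range_sub' (fun k => g k ^ 2) N
    have h2 : g 0 = f x := by simp [hg]
    have h3 : g N = 0 := hN
    rw [h2, h3] at h1
    rw [← sub_zero (f x ^ 2), ← zero_pow two_ne_zero, ← h1]
    exact Finset.sum_congr rfl fun k _ => by ring
  -- These are the midpoints z, with z - e and z + e consecutive points of the line.
  have hinj' : Function.Injective fun k : ℕ => x + (2 * k + 1) • e := by
    intro k l hkl
    have h1 : (fun k : ℕ => k • e) (2 * k + 1) = (fun k : ℕ => k • e) (2 * l + 1) := add_left_cancel hkl
    have := nsmul_left_injective_of_ne_zero he h1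
    omega
  have hdiff : ∑ k ∈ Finset.range N, (g k - g (k + 1)) ^ 2
      ≤ ∑' z, (f (z + e) - f (z - e)) ^ 2 := by
    refine le_trans (Finset.sum_le_sum fun k _ => ?_) (((hD.comp_injective hinj').sum_le_tsum
      (Finset.range N) fun _ _ => sq_nonneg _).trans
        (tsum_comp_le_tsum_of_inj hD (fun _ => sq_nonneg _) hinj'))
    refine le_of_eq ?_
    have h1 : x + (2 * k + 1) • e + e = x + (2 * (k + 1)) • e := by
      rw [add_assoc, ← succ_nsmul]; rfl
    have h2 : x + (2 * k + 1) • e - e = x + (2 * k) • e := by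
      rw [succ_nsmul, ← add_assoc, add_sub_cancel_right]
    simp only [hg, h1, h2]
    ring
  have hsum : ∀ j : ℕ, ∑ k ∈ Finset.range N, g (k + j) ^ 2 ≤ ∑' z, f z ^ 2 := fun j =>
    (((hsq.comp_injective hinj).comp_injective (add_left_injective j)).sum_le_tsum
      (Finset.range N) fun _ _ => sq_nonneg _).trans
      (tsum_comp_le_tsum_of_inj hsq (fun _ => sq_nonneg _)
        (hinj.comp (add_left_injective j)))
  have hadd : ∑ k ∈ Finset.range N, (g k + g (k + 1)) ^ 2 ≤ 4 * ∑' z, f z ^ 2 := by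
    have h1 : ∑ k ∈ Finset.range N, (g k + g (k + 1)) ^ 2
        ≤ ∑ k ∈ Finset.range N, (2 * g (k + 0) ^ 2 + 2 * g (k + 1) ^ 2) :=
      Finset.sum_le_sum fun k _ => by
        have := sq_nonneg (g k - g (k + 1))
        rw [add_zero]
        linarith
    rw [Finset.sum_add_distrib, ← Finset.mul_sum, ← Finset.mul_sum] at h1
    linarith [hsum 0, hsum 1]
  calc f x ^ 4 = (f x ^ 2) ^ 2 := by ring
    _ ≤ (∑ k ∈ Finset.range N, (g k - g (k + 1)) ^ 2)
          * ∑ k ∈ Finset.range N, (g k + g (k + 1)) ^ 2 := by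
        rw [htel]
        exact Finset.sum_mul_sq_le_sq_mul_sq _ _ _
    _ ≤ (∑' z, (f (z + e) - f (z - e)) ^ 2) * (4 * ∑' z, f z ^ 2) :=
        mul_le_mul hdiff hadd (Finset.sum_nonneg fun _ _ => sq_nonneg _)
          (tsum_nonneg fun _ => sq_nonneg _)
    _ = _ := by ring

/-- A nonnegative sequence with `κ aₙ³ ≤ aₙ - aₙ₊₁` decays like `n^(-1/2)`. -/
theorem mul_sq_le_one_of_cube_le_sub {a : ℕ → ℝ} {κ : ℝ} (hκ : 0 ≤ κ) (ha : ∀ n, 0 ≤ a n)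
    (h : ∀ n, κ * a n ^ 3 ≤ a n - a (n + 1)) (n : ℕ) : κ * n * a n ^ 2 ≤ 1 := by
  induction n with
  | zero => simp
  | succ n ih =>
    have h1 : a (n + 1) ≤ a n * (1 - κ * a n ^ 2) := by linarith [h n]
    rcases (ha n).eq_or_lt with h0 | h0
    · have : a (n + 1) = 0 := le_antisymm (by rw [← h0] at h1; simpa using h1) (ha _)
      simp [this]
    -- The recursion gives a(n+1) ≤ a(n)(1 - y), which forces y ≤ 1. With n y ≤ 1 from induction,
    -- the claim reduces to (1 + y)(1 - y)² ≤ 1.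
    · set y := κ * a n ^ 2 with hy
      have hy0 : 0 ≤ y := by positivity
      have hy1 : y ≤ 1 := by
        by_contra! hc
        have : a n * (1 - y) < 0 := mul_neg_of_pos_of_neg h0 (by linarith)
        linarith [ha (n + 1)]
      have h2 : a (n + 1) ^ 2 ≤ (a n * (1 - y)) ^ 2 := pow_le_pow_left₀ (ha _) h1 2
      have h3 : (n : ℝ) * y ≤ 1 := by rw [hy]; linarith
      calc κ * (n + 1 : ℕ) * a (n + 1) ^ 2 ≤ κ * (n + 1 : ℕ) * (a n * (1 - y)) ^ 2 := by gcongr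
        _ = (n * y + y) * (1 - y) ^ 2 := by push_cast; rw [hy]; ring
        _ ≤ (1 + y) * (1 - y) ^ 2 := by gcongr
        _ = (1 - y ^ 2) * (1 - y) := by ring
        _ ≤ 1 * 1 := by gcongr <;> nlinarith
        _ = 1 := one_mul 1

end Nash

/-! ### Nash inequality and decay of the random walk -/

namespace WeightedGraph

section Decay

variable {V : Type*} [AddCommGroup V] [IsAddTorsionFree V] {G : WeightedGraph V}

/-- A Nash inequality for the two-step walk. -/
theorem LocallyFinite.nash (h : G.LocallyFinite) {c : ℝ} (hc : 0 < c)
    (hdeg : ∀ x, c ≤ G.degree x) {e : V} (he : e ≠ 0) (hp : ∀ z, c ≤ G.w z (z + e))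
    (hm : ∀ z, c ≤ G.w z (z - e)) {f : V → ℝ} (hf : f.support.Finite) :
    c ^ 2 * (∑' x, G.degree x * f x ^ 2) ^ 3 ≤ 8 * (∑' x, G.degree x * |f x|) ^ 4
      * (∑' x, G.degree x * f x ^ 2 - ∑' x, G.degree x * G.walk f x ^ 2) := by
  have hdeg' : ∀ x, 0 < G.degree x := fun x => hc.trans_le (hdeg x)
  have hsq : Summable fun z => f z ^ 2 := summable_of_hasFiniteSupport (support_sq_finite hf)
  have hS2 := summable_degree_mul (G := G) (support_sq_finite hf)
  have hS1 := summable_degree_mul (G := G) (support_abs_finite hf)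
  have hne := add_ne_sub_of_ne_zero he
  have hD := summable_sq_sub_shift e hsq
  have hE := h.le_tsum_sq_sub_tsum_walk_sq hdeg' hc.le hne hp hm hf hD
  set S := ∑' x, G.degree x * f x ^ 2 with hS
  set K := ∑' x, G.degree x * |f x| with hK
  set E := S - ∑' x, G.degree x * G.walk f x ^ 2 with hEdef
  have hS0 : 0 ≤ S := tsum_nonneg fun x => mul_nonneg (degree_nonneg x) (sq_nonneg _)
  have hK0 : 0 ≤ K := tsum_nonneg fun x => mul_nonneg (degree_nonneg x) (abs_nonneg _)
  have hD0 : 0 ≤ ∑' z, (f (z + e) - f (z - e)) ^ 2 := tsum_nonneg fun _ => sq_nonneg _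
  have hE0 : 0 ≤ E := le_trans (by positivity) hE
  have hcS : c * ∑' z, f z ^ 2 ≤ S := by
    rw [← tsum_mul_left]
    exact (hsq.mul_left c).tsum_le_tsum
      (fun x => mul_le_mul_of_nonneg_right (hdeg x) (sq_nonneg _)) hS2
  -- From f(x)⁴ ≤ 4 (∑ differences²)(∑ f²), with the first sum at most 2E/c and the second at most
  -- S/c.
  set B := 8 * E * S / c ^ 2 with hB
  have hB0 : 0 ≤ B := by positivity
  have hbound : ∀ x, f x ^ 4 ≤ B := by
    intro x
    refine (pow_four_le_of_finite_support he hf x).trans ?_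
    rw [hB, le_div_iff₀ (by positivity)]
    have h1 : c / 2 * (∑' z, (f (z + e) - f (z - e)) ^ 2) * (c * ∑' z, f z ^ 2) ≤ E * S :=
      mul_le_mul hE hcS (mul_nonneg hc.le (tsum_nonneg fun _ => sq_nonneg _)) hE0
    linarith
  set M := B ^ (1 / 4 : ℝ) with hM
  have hM0 : 0 ≤ M := by positivity
  have hM4 : M ^ 4 = B := by
    rw [hM, ← Real.rpow_natCast, ← Real.rpow_mul hB0]
    norm_num
  have habs : ∀ x, |f x| ≤ M := by
    intro x
    refine le_of_pow_le_pow_left₀ (n := 4) (by norm_num) hM0 ?_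
    rw [hM4, Even.pow_abs (by decide)]
    exact hbound x
  -- The ℓ² norm is interpolated between the sup bound M and the ℓ¹ norm K; the fourth power gives
  -- S⁴ ≤ B K⁴, and one factor S cancels since B is linear in S.
  have hSM : S ≤ M * K := by
    rw [hK, ← tsum_mul_left]
    refine hS2.tsum_le_tsum (fun x => ?_) (hS1.mul_left M)
    rw [← sq_abs]
    have h1 := mul_le_mul_of_nonneg_right (habs x)
      (mul_nonneg (degree_nonneg (G := G) x) (abs_nonneg (f x)))
    linarith
  have h4 : S ^ 4 ≤ B * K ^ 4 := by
    rw [← hM4, ← mul_pow]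
    exact pow_le_pow_left₀ hS0 hSM 4
  rcases hS0.eq_or_lt with h0 | h0
  · rw [← h0]
    have : 0 ≤ 8 * K ^ 4 * E := by positivity
    simpa using this
  · refine le_of_mul_le_mul_right ?_ h0
    have h5 : c ^ 2 * B = 8 * E * S := by
      rw [hB]
      field_simp
    calc c ^ 2 * S ^ 3 * S = c ^ 2 * S ^ 4 := by ring
      _ ≤ c ^ 2 * (B * K ^ 4) := by gcongr
      _ = (c ^ 2 * B) * K ^ 4 := by ring
      _ = 8 * K ^ 4 * E * S := by rw [h5]; ring

/-- Uniform polynomial decay of the iterates of the transition operator. -/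
theorem LocallyFinite.exists_abs_walk_iterate_le (h : G.LocallyFinite) {c : ℝ} (hc : 0 < c)
    (hdeg : ∀ x, c ≤ G.degree x) {e : V} (he : e ≠ 0) (hp : ∀ z, c ≤ G.w z (z + e))
    (hm : ∀ z, c ≤ G.w z (z - e)) {f : V → ℝ} (hf : f.support.Finite) :
    ∃ C : ℝ, 0 ≤ C ∧ ∀ (n : ℕ) (x : V),
      |G.walk^[n + 1] f x| ≤ C * ((n : ℝ) + 1) ^ (-(1 / 4) : ℝ) := by
  have hdeg' : ∀ x, 0 < G.degree x := fun x => hc.trans_le (hdeg x)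
  -- The added 1 keeps K positive even for f = 0, so that κ below is positive.
  set K := ∑' x, G.degree x * |f x| + 1 with hK
  have hK0 : 0 < K := add_pos_of_nonneg_of_pos
    (tsum_nonneg fun x => mul_nonneg (degree_nonneg x) (abs_nonneg _)) one_pos
  set a : ℕ → ℝ := fun n => ∑' x, G.degree x * (G.walk^[n] f x) ^ 2 with ha
  have ha0 : ∀ n, 0 ≤ a n := fun n =>
    tsum_nonneg fun x => mul_nonneg (degree_nonneg x) (sq_nonneg _)
  set κ := c ^ 2 / (8 * K ^ 4) with hκ
  have hκ0 : 0 < κ := by positivity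
  have hfn := fun n => h.walk_iterate_support_finite hf n
  have hstep : ∀ n, κ * a n ^ 3 ≤ a n - a (n + 1) := by
    intro n
    have h1 := h.nash hc hdeg he hp hm (hfn n)
    have h2 : a (n + 1) = ∑' x, G.degree x * G.walk (G.walk^[n] f) x ^ 2 := by
      simp only [ha, Function.iterate_succ_apply']
    rw [← h2] at h1
    change c ^ 2 * a n ^ 3 ≤ _ * (a n - a (n + 1)) at h1
    have h3 : ∑' x, G.degree x * |G.walk^[n] f x| ≤ K :=
      (h.tsum_degree_mul_abs_walk_iterate_le hdeg' hf n).trans (by linarith)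
    have h4 : 0 ≤ ∑' x, G.degree x * |G.walk^[n] f x| :=
      tsum_nonneg fun x => mul_nonneg (degree_nonneg x) (abs_nonneg _)
    have h5 : 0 ≤ a n - a (n + 1) := by
      rw [h2]
      have hsum : ∀ g : V → ℝ, g.support.Finite → Summable fun x => G.degree x * g x ^ 2 :=
        fun g hg => summable_degree_mul (support_sq_finite hg)
      -- The energy bound with constant 0 says that the ℓ² norm does not increase.
      refine le_trans ?_ (h.le_tsum_sq_sub_tsum_walk_sq hdeg' le_rfl (σ := fun z => z + e)
        (τ := fun z => z - e) (add_ne_sub_of_ne_zero he) (fun z => hc.le.trans (hp z))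
        (fun z => hc.le.trans (hm z)) (hfn n) ?_)
      · simp
      · exact summable_sq_sub_shift e (summable_of_hasFiniteSupport (support_sq_finite (hfn n)))
    rw [hκ, div_mul_eq_mul_div, div_le_iff₀ (by positivity)]
    calc c ^ 2 * a n ^ 3 ≤ _ := h1
      _ ≤ 8 * K ^ 4 * (a n - a (n + 1)) := by gcongr
      _ = _ := by ring
  have hdecay := mul_sq_le_one_of_cube_le_sub hκ0.le ha0 hstep
  -- The decay κ(n+1)a(n+1)² ≤ 1 and c(P^(n+1)f(x))² ≤ a(n+1) together give (P^(n+1)f(x))⁴ ≤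
  -- D/(n+1).
  set D := 1 / (κ * c ^ 2) with hD
  have hD0 : 0 < D := by positivity
  refine ⟨D ^ (1 / 4 : ℝ), by positivity, fun n x => ?_⟩
  have hn : (0 : ℝ) < n + 1 := by positivity
  refine le_of_pow_le_pow_left₀ (n := 4) (by norm_num) (by positivity) ?_
  have h1 : (D ^ (1 / 4 : ℝ) * ((n : ℝ) + 1) ^ (-(1 / 4) : ℝ)) ^ 4 = D / (n + 1) := by
    rw [mul_pow, ← Real.rpow_natCast, ← Real.rpow_natCast, ← Real.rpow_mul hD0.le,
      ← Real.rpow_mul hn.le]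
    norm_num [Real.rpow_neg_one, div_eq_mul_inv]
  rw [h1, Even.pow_abs (by decide), le_div_iff₀ hn, hD, le_div_iff₀ (by positivity)]
  have h2 : c * (G.walk^[n + 1] f x) ^ 2 ≤ a (n + 1) :=
    (mul_le_mul_of_nonneg_right (hdeg x) (sq_nonneg _)).trans
      ((summable_degree_mul (support_sq_finite (hfn (n + 1)))).le_tsum x
        fun y _ => mul_nonneg (degree_nonneg y) (sq_nonneg _))
  have h3 : (c * (G.walk^[n + 1] f x) ^ 2) ^ 2 ≤ a (n + 1) ^ 2 :=
    pow_le_pow_left₀ (by positivity) h2 2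
  have h4 := hdecay (n + 1)
  push_cast at h4
  calc (G.walk^[n + 1] f x) ^ 4 * (n + 1) * (κ * c ^ 2)
      = κ * (n + 1) * (c * (G.walk^[n + 1] f x) ^ 2) ^ 2 := by ring
    _ ≤ κ * (n + 1) * a (n + 1) ^ 2 := by gcongr
    _ ≤ 1 := h4

end Decay

end WeightedGraph

/-! ### Convergence in L^p of series with coefficients bounded by 1/(n+1) -/

section SeriesOfFunctions

theorem summable_abs_mul_of_le_div {b : ℕ → ℝ} (hb0 : ∀ n, 0 ≤ b n)
    (hb : Summable fun n : ℕ => b n / (n + 1)) {c : ℕ → ℝ} (hc : ∀ n, |c n| ≤ 1 / (n + 1)) :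
    Summable fun n => |c n| * b n :=
  hb.of_nonneg_of_le (fun n => mul_nonneg (abs_nonneg _) (hb0 n)) fun n =>
    (mul_le_mul_of_nonneg_right (hc n) (hb0 n)).trans_eq (by ring)

theorem summable_mul_of_le_div {α : Type*} {U : ℕ → α → ℝ} {x : α}
    (hx : Summable fun n : ℕ => |U n x| / (n + 1))
    {c : ℕ → ℝ} (hc : ∀ n, |c n| ≤ 1 / (n + 1)) : Summable fun n => c n * U n x := by
  refine Summable.of_norm ?_
  simpa only [norm_mul, Real.norm_eq_abs] using
    summable_abs_mul_of_le_div (fun n => abs_nonneg (U n x)) hx hc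

variable {α : Type*} [MeasurableSpace α] {μ : Measure α} {p : ℝ≥0∞}

/-- The triangle inequality bounds the partial sums, and Fatou passes to the pointwise limit; this
also covers p = ∞. -/
theorem eLpNorm_tsum_le_of_le {g : ℕ → α → ℝ} {b : ℕ → ℝ} (hp : 1 ≤ p)
    (hm : ∀ n, AEStronglyMeasurable (g n) μ) (hb0 : ∀ n, 0 ≤ b n) (hb : Summable b)
    (hg : ∀ n, eLpNorm (g n) p μ ≤ ENNReal.ofReal (b n)) (hs : ∀ x, Summable fun n => g n x) :
    eLpNorm (fun x => ∑' n, g n x) p μ ≤ ENNReal.ofReal (∑' n, b n) := by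
  have hle : ∀ N, eLpNorm (∑ n ∈ Finset.range N, g n) p μ ≤ ENNReal.ofReal (∑' n, b n) := by
    intro N
    refine (eLpNorm_sum_le (fun n _ => hm n) hp).trans ?_
    refine (Finset.sum_le_sum fun n _ => hg n).trans ?_
    rw [← ENNReal.ofReal_sum_of_nonneg fun n _ => hb0 n]
    exact ENNReal.ofReal_le_ofReal (hb.sum_le_tsum _ fun n _ => hb0 n)
  refine (Lp.eLpNorm_lim_le_liminf_eLpNorm (f := fun N => ∑ n ∈ Finset.range N, g n)
    (fun N => Finset.aestronglyMeasurable_sum _ fun n _ => hm n) _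
    (Eventually.of_forall fun x => ?_)).trans ?_
  · simpa only [Finset.sum_apply] using (hs x).hasSum.tendsto_sum_nat
  · exact liminf_le_of_le (by isBoundedDefault) fun c hc =>
      let ⟨N, h⟩ := hc.exists; h.trans (hle N)

variable {U : ℕ → α → ℝ} {b : ℕ → ℝ}

theorem eLpNorm_const_mul_le (hU : ∀ n, eLpNorm (U n) p μ ≤ ENNReal.ofReal (b n)) (c : ℕ → ℝ)
    (n : ℕ) : eLpNorm (fun x => c n * U n x) p μ ≤ ENNReal.ofReal (|c n| * b n) := by
  have h := eLpNorm_const_smul_le (c := c n) (f := U n) (p := p) (μ := μ)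
  rw [ENNReal.ofReal_mul (abs_nonneg _), ← Real.enorm_eq_ofReal_abs]
  exact h.trans (mul_le_mul_right (hU n) _)

variable (hp : 1 ≤ p) (hm : ∀ n, AEStronglyMeasurable (U n) μ) (hb0 : ∀ n, 0 ≤ b n)
  (hb : Summable fun n : ℕ => b n / (n + 1))
  (hU : ∀ n, eLpNorm (U n) p μ ≤ ENNReal.ofReal (b n))
  (hx : ∀ x, Summable fun n : ℕ => |U n x| / (n + 1))

include hp hm hb0 hb hU hx

theorem eLpNorm_tsum_mul_le {c : ℕ → ℝ} (hc : ∀ n, |c n| ≤ 1 / (n + 1)) :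
    eLpNorm (fun x => ∑' n, c n * U n x) p μ ≤ ENNReal.ofReal (∑' n, |c n| * b n) :=
  eLpNorm_tsum_le_of_le hp (fun n => (hm n).const_mul _)
    (fun n => mul_nonneg (abs_nonneg _) (hb0 n)) (summable_abs_mul_of_le_div hb0 hb hc)
    (eLpNorm_const_mul_le hU c) fun x => summable_mul_of_le_div (hx x) hc

/-- Dominated convergence for the norm series ∑ |c i n| b n, with majorant b n / (n+1). -/
theorem tendsto_eLpNorm_tsum_mul {ι : Type*} {l : Filter ι} {c : ι → ℕ → ℝ}
    (hc : ∀ᶠ i in l, ∀ n, |c i n| ≤ 1 / (n + 1)) (hlim : ∀ n, Tendsto (fun i => c i n) l (𝓝 0)) :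
    Tendsto (fun i => eLpNorm (fun x => ∑' n, c i n * U n x) p μ) l (𝓝 0) := by
  have h : Tendsto (fun i => ∑' n, |c i n| * b n) l (𝓝 (∑' _ : ℕ, (0 : ℝ))) := by
    refine tendsto_tsum_of_dominated_convergence hb (fun n => ?_) ?_
    · simpa using ((hlim n).abs).mul_const (b n)
    · filter_upwards [hc] with i hi n
      rw [Real.norm_eq_abs, abs_of_nonneg (mul_nonneg (abs_nonneg _) (hb0 n))]
      exact (mul_le_mul_of_nonneg_right (hi n) (hb0 n)).trans_eq (by ring)
  rw [tsum_zero] at h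
  have h1 := ENNReal.tendsto_ofReal h
  rw [ENNReal.ofReal_zero] at h1
  refine tendsto_of_tendsto_of_tendsto_of_le_of_le' tendsto_const_nhds h1
    (Eventually.of_forall fun _ => zero_le) ?_
  filter_upwards [hc] with i hi
  exact eLpNorm_tsum_mul_le hp hm hb0 hb hU hx hi

/-- The error is again such a series, with coefficients 0 before N and -c n from N on; each of them
is eventually 0. -/
theorem tendsto_eLpNorm_sum_sub_tsum {c : ℕ → ℝ} (hc : ∀ n, |c n| ≤ 1 / (n + 1)) :
    Tendsto (fun N => eLpNorm (fun x => ∑ n ∈ Finset.range N, c n * U n x - ∑' n, c n * U n x) p μ)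
      atTop (𝓝 0) := by
  classical
  have heq : ∀ N x, ∑ n ∈ Finset.range N, c n * U n x - ∑' n, c n * U n x
      = ∑' n, (if n ∈ Finset.range N then 0 else -c n) * U n x := by
    intro N x
    have hs := summable_mul_of_le_div (hx x) hc
    have h1 : HasSum (fun n => if n ∈ Finset.range N then c n * U n x else 0)
        (∑ n ∈ Finset.range N, c n * U n x) := by
      have := hasSum_sum_of_ne_finset_zero (L := .unconditional ℕ) (f := fun n => if n ∈ Finset.range N then c n * U n x
        else 0) (s := Finset.range N) fun n hn => if_neg hn
      rwa [Finset.sum_congr rfl fun n hn => if_pos hn] at this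
    rw [← (h1.sub hs.hasSum).tsum_eq]
    refine tsum_congr fun n => ?_
    split_ifs <;> ring
  simp only [heq]
  refine tendsto_eLpNorm_tsum_mul hp hm hb0 hb hU hx (Eventually.of_forall fun N n => ?_)
    fun n => ?_
  · split_ifs
    · rw [abs_zero]
      positivity
    · rw [abs_neg]
      exact hc n
  · refine tendsto_const_nhds.congr' ?_
    filter_upwards [eventually_gt_atTop n] with N hN
    rw [if_pos (Finset.mem_range.2 hN)]

end SeriesOfFunctions

/-! ### The transition operator as `1 - (-Δ)` on ℓ² -/

namespace WeightedGraph

variable {V : Type*} [MeasurableSpace V] [MeasurableSingletonClass V] {G : WeightedGraph V}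

open scoped ComplexOrder in
theorem isSelfAdjoint_negLaplacian : IsSelfAdjoint G.negLaplacian :=
  G.negLaplacian_isPositive.isSelfAdjoint

/-- With S, T the isometric pullbacks to edges along the two endpoints, expanding the energy form
cancels the diagonal terms and leaves half of ⟪Sg, Tf⟫ + ⟪Tg, Sf⟫. Taking g = (1 - (-Δ))f then
yields contractivity. -/
theorem norm_inner_one_sub_negLaplacian_le (g f : Lp ℂ 2 G.vertexMeasure) :
    ‖⟪g, (1 - G.negLaplacian) f⟫_ℂ‖ ≤ ‖g‖ * ‖f‖ := by
  set S := Lp.compMeasurePreservingₗᵢ ℂ (E := ℂ) (p := 2) Prod.fst G.measurePreserving_fst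
  set T := Lp.compMeasurePreservingₗᵢ ℂ (E := ℂ) (p := 2) Prod.snd G.measurePreserving_snd
  have hgrad : ∀ g, G.gradient g = S g - T g := fun g => rfl
  have h1 : ⟪g, (1 - G.negLaplacian) f⟫_ℂ = (1 / 2 : ℂ) * (⟪S g, T f⟫_ℂ + ⟪T g, S f⟫_ℂ) := by
    rw [sub_apply, one_apply_eq_self, inner_sub_right, negLaplacian, smul_apply,
      inner_smul_right, ContinuousLinearMap.comp_apply, ContinuousLinearMap.adjoint_inner_right,
      hgrad, hgrad, inner_sub_left, inner_sub_right, inner_sub_right, S.inner_map_map,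
      T.inner_map_map]
    ring
  have h2 := norm_add_le ⟪S g, T f⟫_ℂ ⟪T g, S f⟫_ℂ
  have h3 := norm_inner_le_norm (𝕜 := ℂ) (S g) (T f)
  have h4 := norm_inner_le_norm (𝕜 := ℂ) (T g) (S f)
  rw [S.norm_map, T.norm_map] at h3 h4
  rw [h1, norm_mul, norm_div, norm_one, Complex.norm_ofNat]
  linarith

theorem norm_one_sub_negLaplacian_apply_le (f : Lp ℂ 2 G.vertexMeasure) :
    ‖(1 - G.negLaplacian) f‖ ≤ ‖f‖ := by
  generalize hg : (1 - G.negLaplacian) f = g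
  have h1 := norm_inner_one_sub_negLaplacian_le g f
  rw [hg, inner_self_eq_norm_sq_to_K, norm_pow, RCLike.norm_ofReal, abs_norm, sq] at h1
  rcases (norm_nonneg g).eq_or_lt with h | h
  · rw [← h]
    exact norm_nonneg f
  · exact le_of_mul_le_mul_left h1 h

theorem norm_one_sub_negLaplacian_pow_apply_le (n : ℕ) (f : Lp ℂ 2 G.vertexMeasure) :
    ‖((1 - G.negLaplacian) ^ n) f‖ ≤ ‖f‖ := by
  induction n with
  | zero => rw [pow_zero, one_apply_eq_self]
  | succ n ih =>
    rw [pow_succ', mul_apply_eq_comp]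
    exact (norm_one_sub_negLaplacian_apply_le _).trans ih

theorem memLp_of_support_finite {f : V → ℝ} (hf : f.support.Finite) {p : ℝ≥0∞} (hp : 1 ≤ p)
    (hm : AEStronglyMeasurable f G.vertexMeasure) : MemLp f p G.vertexMeasure := by
  refine ⟨hm, (eLpNorm_le_of_bound_of_eLpNorm_one_le (M := ∑' x, |f x|)
    (tsum_nonneg fun x => abs_nonneg _)
    (tsum_nonneg fun x => mul_nonneg (degree_nonneg x) (abs_nonneg _)) (fun x => ?_)
    (eLpNorm_one_vertexMeasure hf).le hp).trans_lt ENNReal.ofReal_lt_top⟩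
  exact (summable_of_hasFiniteSupport (support_abs_finite hf)).le_tsum x fun _ _ => abs_nonneg _

variable [Countable V]

/-- A real function of finite support as an element of `ℓ²(V, μ)`. -/
def toL2 (G : WeightedGraph V) {f : V → ℝ} (hf : f.support.Finite) : Lp ℂ 2 G.vertexMeasure :=
  (memLp_of_support_finite (G := G) hf one_le_two
    (measurable_of_countable f).aestronglyMeasurable).ofReal.toLp _

theorem toL2_apply (hdeg : ∀ x, 0 < G.degree x) {f : V → ℝ} (hf : f.support.Finite) (x : V) :
    G.toL2 hf x = f x :=
  eq_of_ae_vertexMeasure hdeg (MemLp.coeFn_toLp _) x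

theorem norm_toL2 {f : V → ℝ} (hf : f.support.Finite) :
    ‖G.toL2 hf‖ = (eLpNorm f 2 G.vertexMeasure).toReal := by
  rw [toL2, Lp.norm_toLp]
  congr 1
  exact eLpNorm_congr_norm_ae (Eventually.of_forall fun x => by simp)

theorem LocallyFinite.one_sub_negLaplacian_toL2 (h : G.LocallyFinite)
    (hdeg : ∀ x, 0 < G.degree x) {f : V → ℝ} (hf : f.support.Finite) :
    (1 - G.negLaplacian) (G.toL2 hf) = G.toL2 (h.walk_support_finite hf) := by
  refine Lp.ext (Eventually.of_forall fun x => ?_)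
  rw [sub_apply, one_apply_eq_self,
    eq_of_ae_vertexMeasure hdeg (Lp.coeFn_sub (G.toL2 hf) (G.negLaplacian (G.toL2 hf))) x,
    Pi.sub_apply, G.negLaplacian_apply _ x (hdeg x), toL2_apply hdeg]
  simp only [toL2_apply hdeg]
  have h1 : ∀ y, (G.w x y : ℂ) * ((f x : ℂ) - f y)
      = ((G.w x y * f x - G.w x y * f y : ℝ) : ℂ) := fun y => by push_cast; ring
  simp only [h1]
  rw [← Complex.ofReal_tsum, ((G.summable x).mul_right _).tsum_sub (h.summable_mul x f),
    tsum_mul_right]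
  change _ - ((G.degree x : ℝ) : ℂ)⁻¹ * ((G.degree x * f x - ∑' y, G.w x y * f y : ℝ) : ℂ) = _
  have h2 : G.walk f x = f x - (G.degree x)⁻¹ * (G.degree x * f x - ∑' y, G.w x y * f y) := by
    rw [mul_sub, inv_mul_cancel_left₀ (hdeg x).ne', walk]
    ring
  rw [h2]
  simp only [Complex.ofReal_sub, Complex.ofReal_mul, Complex.ofReal_inv]

theorem LocallyFinite.one_sub_negLaplacian_pow_toL2 (h : G.LocallyFinite)
    (hdeg : ∀ x, 0 < G.degree x) {f : V → ℝ} (hf : f.support.Finite) (n : ℕ) :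
    ((1 - G.negLaplacian) ^ n) (G.toL2 hf) = G.toL2 (h.walk_iterate_support_finite hf n) := by
  induction n with
  | zero => rfl
  | succ n ih =>
    rw [pow_succ', mul_apply_eq_comp, ih, h.one_sub_negLaplacian_toL2 hdeg]
    simp only [Function.iterate_succ_apply']

/-- If the iterates of the walk decay in `ℓ²` on finitely supported functions, then the powers of
`1 - (-Δ)` tend strongly to zero. -/
theorem LocallyFinite.tendsto_one_sub_negLaplacian_pow (h : G.LocallyFinite) {c : ℝ} (hc : 0 < c)
    (hdeg : ∀ x, c ≤ G.degree x)
    (hlim : ∀ f : V → ℝ, f.support.Finite →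
      Tendsto (fun n => eLpNorm (G.walk^[n] f) 2 G.vertexMeasure) atTop (𝓝 0))
    (w : Lp ℂ 2 G.vertexMeasure) :
    Tendsto (fun n : ℕ => ((1 - G.negLaplacian) ^ n) w) atTop (𝓝 0) := by
  have hdeg' : ∀ x, 0 < G.degree x := fun x => hc.trans_le (hdeg x)
  refine Lp.induction ENNReal.ofNat_ne_top
    (fun w => Tendsto (fun n : ℕ => ((1 - G.negLaplacian) ^ n) w) atTop (𝓝 0))
    (fun a s hs hμs => ?_) (fun f g hf hg _ h1 h2 => ?_) ?_ w
  -- Vertex masses are bounded below, so a set of finite measure is finite.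
  · have hsf : (s.indicator (1 : V → ℝ)).support.Finite :=
      (finite_of_vertexMeasure_lt_top hc hdeg hs hμs).subset Set.support_indicator_subset
    have heq : ((Lp.simpleFunc.indicatorConst 2 hs hμs.ne a : Lp.simpleFunc ℂ 2 G.vertexMeasure) :
        Lp ℂ 2 G.vertexMeasure) = a • G.toL2 hsf := by
      refine Lp.ext (Eventually.of_forall fun x => ?_)
      rw [eq_of_ae_vertexMeasure hdeg' (Lp.coeFn_smul a (G.toL2 hsf)) x, Pi.smul_apply,
        toL2_apply hdeg', Lp.simpleFunc.coe_indicatorConst,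
        eq_of_ae_vertexMeasure hdeg' indicatorConstLp_coeFn x]
      by_cases hx : x ∈ s <;> simp [hx]
    rw [heq]
    simp only [map_smul, h.one_sub_negLaplacian_pow_toL2 hdeg' hsf]
    suffices hs : Tendsto (fun n => G.toL2 (h.walk_iterate_support_finite hsf n)) atTop (𝓝 0) by
      simpa using hs.const_smul a
    rw [tendsto_zero_iff_norm_tendsto_zero]
    simp only [norm_toL2]
    have hreal := (ENNReal.tendsto_toReal ENNReal.zero_ne_top).comp (hlim _ hsf)
    rwa [ENNReal.toReal_zero] at hreal
  · simpa only [map_add, add_zero] using h1.add h2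
  -- The powers are uniformly contractive, so strong convergence passes to limits of vectors.
  · refine isClosed_of_closure_subset fun f hf => ?_
    rw [Set.mem_ofPred_eq, Metric.tendsto_atTop]
    intro ε hε
    obtain ⟨g, hg, hfg⟩ := Metric.mem_closure_iff.1 hf (ε / 2) (by positivity)
    obtain ⟨N, hN⟩ := Metric.tendsto_atTop.1 hg (ε / 2) (by positivity)
    refine ⟨N, fun n hn => ?_⟩
    have h1 := hN n hn
    have h2 := norm_one_sub_negLaplacian_pow_apply_le n (f - g)
    rw [map_sub] at h2
    rw [dist_zero_right] at h1 ⊢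
    rw [dist_eq_norm] at hfg
    have h3 := norm_add_le (((1 - G.negLaplacian) ^ n) f - ((1 - G.negLaplacian) ^ n) g)
      (((1 - G.negLaplacian) ^ n) g)
    rw [sub_add_cancel] at h3
    linarith

end WeightedGraph

/-! ### The logarithm as the derivative of the fractional powers -/

theorem summable_rpow_neg_div {ε : ℝ} (hε : 0 < ε) :
    Summable fun n : ℕ => ((n : ℝ) + 1) ^ (-ε) / (n + 1) := by
  have h := (summable_nat_add_iff 1).2 (Real.summable_nat_rpow (p := -ε - 1).2 (by linarith))
  refine h.congr fun n => ?_
  have hn : (0 : ℝ) < n + 1 := by positivity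
  push_cast
  rw [Real.rpow_sub_one hn.ne']

theorem mul_rpow_neg_rpow {C x : ℝ} (hC : 0 ≤ C) (hx : 0 < x) (a θ K : ℝ) :
    (C * x ^ (-a)) ^ θ * K = C ^ θ * K * x ^ (-(a * θ)) := by
  rw [Real.mul_rpow hC (by positivity), ← Real.rpow_mul hx.le, neg_mul]
  ring

namespace WeightedGraph

variable {V : Type*} [MeasurableSpace V] [MeasurableSingletonClass V] [Countable V]
  {G : WeightedGraph V}

theorem exists_toLp_sum_eq {f : V → ℝ} (hf : f.support.Finite) {g : ℕ → V → ℝ}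
    (hg : ∀ n, (g n).support.Finite) (c : ℕ → ℝ) (a : ℝ) (N : ℕ) :
    ∃ h : MemLp (fun x => ((a * f x + ∑ n ∈ Finset.range N, c n * g n x : ℝ) : ℂ)) 2
        G.vertexMeasure,
      h.toLp _ = a • G.toL2 hf + ∑ n ∈ Finset.range N, c n • G.toL2 (hg n) := by
  have hmem : ∀ {k : V → ℝ}, k.support.Finite → MemLp (fun x => (k x : ℂ)) 2 G.vertexMeasure :=
    fun hk => (memLp_of_support_finite hk one_le_two
      (measurable_of_countable _).aestronglyMeasurable).ofReal
  induction N with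
  | zero =>
    refine ⟨((hmem hf).const_smul a).ae_eq (Eventually.of_forall fun x => by simp), ?_⟩
    rw [Finset.sum_range_zero, add_zero, toL2, ← MemLp.toLp_const_smul]
    exact MemLp.toLp_congr _ _ (Eventually.of_forall fun x => by simp)
  | succ N ih =>
    obtain ⟨h, heq⟩ := ih
    refine ⟨(h.add ((hmem (hg N)).const_smul (c N))).ae_eq (Eventually.of_forall fun x => ?_), ?_⟩
    · simp [Finset.sum_range_succ, add_assoc]
    · rw [Finset.sum_range_succ, ← add_assoc, ← heq, toL2, ← MemLp.toLp_const_smul,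
        ← MemLp.toLp_add]
      exact MemLp.toLp_congr _ _ (Eventually.of_forall fun x => by
        simp [Finset.sum_range_succ, add_assoc])

/-- If the iterates of the walk decay polynomially, then the logarithm of `-Δ` is the derivative
at `s = 0` of its fractional powers on functions of finite support, in `ℓ^p` for all `p > 1`. -/
theorem LocallyFinite.exists_log_fractional (h : G.LocallyFinite) {c : ℝ} (hc : 0 < c)
    (hdeg : ∀ x, c ≤ G.degree x)
    (hdecay : ∀ f : V → ℝ, f.support.Finite → ∃ C : ℝ, 0 ≤ C ∧ ∀ (n : ℕ) (x : V),
      |G.walk^[n + 1] f x| ≤ C * ((n : ℝ) + 1) ^ (-(1 / 4) : ℝ))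
    {u : V → ℝ} (hu : u.support.Finite) :
    ∃ (L : V → ℝ) (F : ℝ → V → ℝ),
      G.IsLogLaplacian u L ∧
      (∀ s ∈ Set.Ioo (0 : ℝ) 1, G.IsFractionalLaplacian s u (F s)) ∧
      ∀ p : ℝ≥0∞, 1 < p →
        MemLp L p G.vertexMeasure ∧
        Tendsto (fun s : ℝ => eLpNorm (fun x => (F s x - u x) / s - L x) p G.vertexMeasure)
          (𝓝[>] 0) (𝓝 0) := by
  have hdeg' : ∀ x, 0 < G.degree x := fun x => hc.trans_le (hdeg x)
  have hm : ∀ f : V → ℝ, AEStronglyMeasurable f G.vertexMeasure := fun f =>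
    (measurable_of_countable f).aestronglyMeasurable
  -- decay of the `ℓ^p` norms
  have hnorm : ∀ f : V → ℝ, f.support.Finite → ∃ C K : ℝ, 0 ≤ C ∧ 0 ≤ K ∧
      (∀ (n : ℕ) (x : V), |G.walk^[n + 1] f x| ≤ C * ((n : ℝ) + 1) ^ (-(1 / 4) : ℝ)) ∧
      ∀ p : ℝ≥0∞, 1 ≤ p → ∀ n : ℕ, eLpNorm (G.walk^[n + 1] f) p G.vertexMeasure
        ≤ ENNReal.ofReal (C ^ (1 - 1 / p.toReal) * K ^ (1 / p.toReal)
          * ((n : ℝ) + 1) ^ (-(1 / 4 * (1 - 1 / p.toReal)))) := by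
    intro f hf
    obtain ⟨C, hC0, hC⟩ := hdecay f hf
    have hK0 : 0 ≤ ∑' x, G.degree x * |f x| :=
      tsum_nonneg fun x => mul_nonneg (degree_nonneg x) (abs_nonneg _)
    refine ⟨C, ∑' x, G.degree x * |f x|, hC0, hK0, hC, fun p hp n => ?_⟩
    rw [← mul_rpow_neg_rpow hC0 (by positivity)]
    refine eLpNorm_le_of_bound_of_eLpNorm_one_le (by positivity) hK0 (hC n) ?_ hp
    rw [eLpNorm_one_vertexMeasure (h.walk_iterate_support_finite hf _)]
    exact ENNReal.ofReal_le_ofReal (h.tsum_degree_mul_abs_walk_iterate_le hdeg' hf _)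
  have hpow := h.tendsto_one_sub_negLaplacian_pow hc hdeg fun f hf => by
    obtain ⟨C, K, -, -, -, hle⟩ := hnorm f hf
    refine (tendsto_add_atTop_iff_nat 1).1 ?_
    refine tendsto_of_tendsto_of_tendsto_of_le_of_le tendsto_const_nhds ?_
      (fun _ => zero_le) (hle 2 one_le_two)
    rw [← ENNReal.ofReal_zero]
    refine ENNReal.tendsto_ofReal ?_
    rw [← mul_zero (C ^ (1 - 1 / (2 : ℝ≥0∞).toReal) * K ^ (1 / (2 : ℝ≥0∞).toReal))]
    refine Tendsto.const_mul _ ?_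
    exact (tendsto_rpow_neg_atTop (by norm_num)).comp
      (tendsto_natCast_atTop_atTop.atTop_add tendsto_const_nhds)
  obtain ⟨C, K, hC0, hK0, hC, hle⟩ := hnorm u hu
  set U : ℕ → V → ℝ := fun n => G.walk^[n + 1] u with hUdef
  have hUfin : ∀ n, (U n).support.Finite := fun n => h.walk_iterate_support_finite hu _
  set b : ℝ≥0∞ → ℕ → ℝ := fun p n => C ^ (1 - 1 / p.toReal) * K ^ (1 / p.toReal)
    * ((n : ℝ) + 1) ^ (-(1 / 4 * (1 - 1 / p.toReal))) with hbdef
  have hb0 : ∀ p n, 0 ≤ b p n := fun p n => by positivity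
  -- The exponent (1 - 1/p)/4 is positive precisely because p > 1; for p = ∞ it is 1/4.
  have hb : ∀ p : ℝ≥0∞, 1 < p → Summable fun n : ℕ => b p n / (n + 1) := by
    intro p hp
    have hθ : 0 < 1 / 4 * (1 - 1 / p.toReal) := by
      rcases eq_or_ne p ∞ with rfl | hp'
      · simp
      · have h1 : 1 < p.toReal := by
          rw [← ENNReal.toReal_one]
          exact (ENNReal.toReal_lt_toReal ENNReal.one_ne_top hp').2 hp
        have h2 : 1 / p.toReal < 1 := (div_lt_one (by linarith)).2 h1
        linarith
    refine ((summable_rpow_neg_div hθ).mul_left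
      (C ^ (1 - 1 / p.toReal) * K ^ (1 / p.toReal))).congr fun n => ?_
    rw [hbdef]
    ring
  have hx : ∀ x, Summable fun n : ℕ => |U n x| / (n + 1) := fun x =>
    ((summable_rpow_neg_div (by norm_num : (0 : ℝ) < 1 / 4)).mul_left C).of_nonneg_of_le
      (fun n => by positivity) fun n => by
        rw [← mul_div_assoc]
        exact div_le_div_of_nonneg_right (hC n x) (by positivity)
  -- convergence of the series in `ℓ²(V, μ)`
  have hseries : ∀ (a : ℝ) (k : ℕ → ℝ), (∀ n, |k n| ≤ 1 / (n + 1)) →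
      ∃ hz : MemLp (fun x => ((a * u x + ∑' n, k n * U n x : ℝ) : ℂ)) 2 G.vertexMeasure,
      Tendsto (fun N => a • G.toL2 hu + ∑ n ∈ Finset.range N,
        k n • ((1 - G.negLaplacian) ^ (n + 1)) (G.toL2 hu)) atTop (𝓝 (hz.toLp _)) := by
    intro a k hk
    have hz : MemLp (fun x => a * u x + ∑' n, k n * U n x) 2 G.vertexMeasure :=
      ((memLp_of_support_finite hu one_le_two (hm u)).const_mul a).add
        ⟨hm _, (eLpNorm_tsum_mul_le one_le_two (fun n => hm _) (hb0 2) (hb 2 ENNReal.one_lt_two)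
          (hle 2 one_le_two) hx hk).trans_lt ENNReal.ofReal_lt_top⟩
    refine ⟨hz.ofReal, ?_⟩
    choose hS hSeq using fun N => exists_toLp_sum_eq (G := G) hu hUfin k a N
    simp only [h.one_sub_negLaplacian_pow_toL2 hdeg' hu]
    change Tendsto (fun N => a • G.toL2 hu + ∑ n ∈ Finset.range N, k n • G.toL2 (hUfin n)) _ _
    simp only [← hSeq]
    rw [Lp.tendsto_Lp_iff_tendsto_eLpNorm'']
    refine (tendsto_eLpNorm_sum_sub_tsum one_le_two (fun n => hm _) (hb0 2) (hb 2 ENNReal.one_lt_two)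
      (hle 2 one_le_two) hx hk).congr fun N => ?_
    refine eLpNorm_congr_norm_ae (Eventually.of_forall fun x => ?_)
    rw [Pi.sub_apply, ← Complex.ofReal_sub, Complex.norm_real, add_sub_add_left_eq_sub]
  have huL : MemLp (fun x => (u x : ℂ)) 2 G.vertexMeasure :=
    (memLp_of_support_finite hu one_le_two (hm u)).ofReal
  -- These are the coefficients of the difference quotient minus the logarithm.
  have hα : ∀ s ∈ Set.Ioo (0 : ℝ) 1, ∀ n : ℕ,
      |(1 - binomialFactor s n) / (n + 1)| ≤ 1 / (n + 1) := by
    intro s hs n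
    have h0 := binomialFactor_nonneg hs.2.le n
    have h1 := binomialFactor_le_one hs.1.le hs.2.le n
    rw [abs_of_nonneg (div_nonneg (by linarith) (by positivity))]
    gcongr
    linarith
  have hlogc : ∀ n : ℕ, |(-1 / (n + 1) : ℝ)| ≤ 1 / (n + 1) := fun n => by
    rw [abs_div, abs_neg, abs_one, abs_of_pos (by positivity)]
  have hfrac : ∀ s ∈ Set.Ioo (0 : ℝ) 1, ∀ n : ℕ,
      |-(s * (binomialFactor s n / (n + 1)))| ≤ 1 / (n + 1) := by
    intro s hs n
    have h0 := binomialFactor_nonneg hs.2.le n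
    have h1 := binomialFactor_le_one hs.1.le hs.2.le n
    rw [abs_neg, abs_of_nonneg (mul_nonneg hs.1.le (by positivity)), ← mul_div_assoc]
    gcongr
    exact mul_le_one₀ hs.2.le h0 h1
  -- The factors 0 and 1 keep both witnesses in the common shape of `hseries`.
  refine ⟨fun x => 0 * u x + ∑' n : ℕ, (-1 / (n + 1) : ℝ) * U n x,
    fun s x => 1 * u x + ∑' n : ℕ, -(s * (binomialFactor s n / (n + 1))) * U n x, ?_, ?_, ?_⟩
  · obtain ⟨hz, hlim⟩ := hseries 0 _ hlogc
    refine ⟨huL, hz, isSpectralValue_log _ isSelfAdjoint_negLaplacian hpow ?_⟩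
    simp only [zero_smul, zero_add] at hlim
    exact hlim
  · intro s hs
    obtain ⟨hz, hlim⟩ := hseries 1 _ (hfrac s hs)
    refine ⟨huL, hz, isSpectralValue_rpow _ isSelfAdjoint_negLaplacian hpow hs.1 hs.2.le ?_⟩
    simp only [one_smul] at hlim
    exact hlim
  · intro p hp
    constructor
    · simp only [zero_mul, zero_add]
      exact ⟨hm _, (eLpNorm_tsum_mul_le hp.le (fun n => hm _) (hb0 p) (hb p hp)
        (hle p hp.le) hx hlogc).trans_lt ENNReal.ofReal_lt_top⟩
    · have hev : ∀ᶠ s : ℝ in 𝓝[>] 0, s ∈ Set.Ioo (0 : ℝ) 1 := Ioo_mem_nhdsGT one_pos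
      refine (tendsto_eLpNorm_tsum_mul hp.le (fun n => hm _) (hb0 p) (hb p hp) (hle p hp.le) hx
        (c := fun s n => (1 - binomialFactor s n) / (n + 1)) (hev.mono hα) fun n => ?_).congr' ?_
      · simpa using ((tendsto_binomialFactor n).const_sub 1).div_const ((n : ℝ) + 1)
      · filter_upwards [hev] with s hs
        congr 1
        ext x
        have h1 := summable_mul_of_le_div (hx x) (hfrac s hs)
        have h2 := summable_mul_of_le_div (hx x) hlogc
        have hs0 : s ≠ 0 := hs.1.ne'
        rw [one_mul, add_sub_cancel_left, zero_mul, zero_add, ← tsum_div_const,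
          ← (h1.div_const s).tsum_sub h2]
        refine tsum_congr fun n => ?_
        have hn : ((n : ℝ) + 1) ≠ 0 := by positivity
        field_simp
        ring

end WeightedGraph

/-! ### Weighted lattices -/

theorem IsWeightedLattice.locallyFinite {d : ℕ} {G : WeightedGraph (Fin d → ℤ)}
    (hG : IsWeightedLattice G) : G.LocallyFinite := by
  intro x
  refine (Set.finite_Icc (x - 1) (x + 1)).subset fun y hy => ?_
  have h1 : ∑ i, |x i - y i| = 1 := (hG x y).1 ((G.nonneg x y).lt_of_ne' hy)
  have h2 : ∀ i, |x i - y i| ≤ 1 := fun i =>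
    h1 ▸ Finset.single_le_sum (f := fun i => |x i - y i|) (fun _ _ => abs_nonneg _)
      (Finset.mem_univ i)
  refine ⟨fun i => ?_, fun i => ?_⟩ <;>
  · have := abs_le.1 (h2 i)
    simp only [Pi.sub_apply, Pi.add_apply, Pi.one_apply]
    omega

end

theorem theorem1p6 {d : ℕ} (hd : 1 ≤ d) (G : WeightedGraph (Fin d → ℤ))
    (hG : IsWeightedLattice G)
    (hμmin : ∃ c : ℝ, 0 < c ∧ ∀ x, c ≤ G.degree x)
    (hμmax : ∃ C : ℝ, ∀ x, G.degree x ≤ C)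
    (hwmin : ∃ c : ℝ, 0 < c ∧ ∀ x y, 0 < G.w x y → c ≤ G.w x y)
    (u : (Fin d → ℤ) → ℝ) (hu : u.support.Finite) :
    ∃ (L : (Fin d → ℤ) → ℝ) (F : ℝ → (Fin d → ℤ) → ℝ),
      G.IsLogLaplacian u L ∧
      (∀ s ∈ Set.Ioo (0 : ℝ) 1, G.IsFractionalLaplacian s u (F s)) ∧
      ∀ p : ℝ≥0∞, 1 < p →
        MemLp L p G.vertexMeasure ∧
        Tendsto (fun s : ℝ => eLpNorm (fun x => (F s x - u x) / s - L x) p G.vertexMeasure)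
          (𝓝[>] 0) (𝓝 0) := by
  obtain ⟨c₁, hc₁, hdeg⟩ := hμmin
  obtain ⟨c₂, hc₂, hw⟩ := hwmin
  -- One coordinate direction suffices for the Nash argument; it exists because d ≥ 1.
  set e : Fin d → ℤ := Pi.single ⟨0, hd⟩ 1 with he
  have he0 : e ≠ 0 := by simp [he]
  have hsum : ∑ i, |e i| = 1 := by
    rw [Finset.sum_eq_single ⟨0, hd⟩ (fun i _ hi => by simp [he, hi]) (by simp)]
    simp [he]
  have hp : ∀ z, 0 < G.w z (z + e) := fun z => (hG _ _).2 (by simpa using hsum)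
  have hm : ∀ z, 0 < G.w z (z - e) := fun z => (hG _ _).2 (by simpa using hsum)
  have hc : 0 < min c₁ c₂ := lt_min hc₁ hc₂
  have hdeg' : ∀ x, min c₁ c₂ ≤ G.degree x := fun x => (min_le_left _ _).trans (hdeg x)
  exact hG.locallyFinite.exists_log_fractional hc hdeg' (fun f hf =>
    hG.locallyFinite.exists_abs_walk_iterate_le hc hdeg' he0
      (fun z => (min_le_right _ _).trans (hw _ _ (hp z)))
      (fun z => (min_le_right _ _).trans (hw _ _ (hm z))) hf) hu
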